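/- Let $R$ be a left and right Noetherian associative ring with identity. A module $G$ (over a ring $S$) is Gorenstein projective if there is an exact sequence $\cdots\to P_1\to P_0\to P^0\to P^1\to\cdots$ of projective $S$-modules which stays exact under $\operatorname{Hom}_S(-,Q)$ for every projective $S$-module $Q$, and $G\cong\operatorname{Im}(P_0\to P^0)$. The Gorenstein projective dimension $\operatorname{Gpd}_R(M)$ is the infimum of all $n\ge 0$ for which there exists an exact sequence $0\to G_n\to\cdots\to G_0\to M\to 0$ with all $G_i$ Gorenstein projective ($\infty$ if there is none). The projective dimension is denoted by $\operatorname{pd}_R$; both dimensions of the zero module are $0$. Let $(-)^*=\operatorname{Hom}(-,R)$, which exchanges left and right $R$-modules. For a finitely generated (left or right) $R$-module $C$, a transpose (respectively, a Gorenstein transpose) of $C$ is any module isomorphic to $\operatorname{Coker}(f^*\colon X_0^*\to X_1^*)$ for some exact sequence $X_1\xrightarrow{f}X_0\to C\to 0$ with $X_0,X_1$ finitely generated projective (respectively, finitely generated Gorenstein projective). **Proposition 3.6.** Let $A$ be a finitely generated left $R$-module and $n$ a non-negative integer. Then $\operatorname{Gpd}_R(A)=n$ if and only if there exists a finitely generated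 left $R$-module $B$ with $\operatorname{pd}_R(B)=n$ such that $A$ is a Gorenstein transpose of some transpose $\operatorname{Tr}B$ of $B$ (a right $R$-module). -/

import Mathlib

open CategoryTheory

universe u

/-- A (left) module `G` over a ring `S` is Gorenstein projective if there is an exact sequence
`⋯ → P (-1) → P 0 → P 1 → P 2 → ⋯` of projective modules that stays exact under `Hom_S(-, Q)`
for every projective module `Q`, and `G` is isomorphic to the image of `P 0 → P 1`. -/
def IsGorensteinProjective (S : Type u) [Ring S] (G : Type u) [AddCommGroup G] [Module S G] :
    Prop :=
  ∃ (P : ℤ → ModuleCat.{u} S) (d : ∀ i : ℤ, P i →ₗ[S] P (i + 1)),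
    (∀ i, Module.Projective S (P i)) ∧
    (∀ i, Function.Exact (d i) (d (i + 1))) ∧
    (∀ Q : ModuleCat.{u} S, Module.Projective S Q → ∀ i,
      Function.Exact (fun φ : P (i + 1 + 1) →ₗ[S] Q => φ ∘ₗ d (i + 1))
        (fun φ : P (i + 1) →ₗ[S] Q => φ ∘ₗ d i)) ∧
    Nonempty (G ≃ₗ[S] LinearMap.range (d 0))

/-- There is an exact sequence `0 → G n → ⋯ → G 1 → G 0 → M → 0` with all `G i` Gorenstein
projective (the sequence is continued by zero modules beyond `n`). -/
def HasGorensteinProjectiveResolution (S : Type u) [Ring S] (M : Type u) [AddCommGroup M]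
    [Module S M] (n : ℕ) : Prop :=
  ∃ (G : ℕ → ModuleCat.{u} S) (d : ∀ i : ℕ, G (i + 1) →ₗ[S] G i) (ε : G 0 →ₗ[S] M),
    (∀ i ≤ n, IsGorensteinProjective S (G i)) ∧
    (∀ i, n < i → Subsingleton (G i)) ∧
    Function.Surjective ε ∧
    Function.Exact (d 0) ε ∧
    ∀ i, Function.Exact (d (i + 1)) (d i)

/-- The Gorenstein projective dimension: the infimum of the lengths of the Gorenstein projective
resolutions, `⊤` if there is none; the zero module has dimension `0`. -/
noncomputable def gorensteinProjectiveDim (S : Type u) [Ring S] (M : Type u) [AddCommGroup M]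
    [Module S M] : ℕ∞ :=
  ⨅ (n : ℕ) (_ : HasGorensteinProjectiveResolution S M n), (n : ℕ∞)

/-- The projective dimension with values in `ℕ∞`, so that, as for the Gorenstein projective
dimension, the zero module has dimension `0` (Mathlib's `projectiveDimension` has value `⊥`
there, and agrees with this one on all other modules). -/
noncomputable def projectiveDim (S : Type u) [Ring S] (M : Type u) [AddCommGroup M]
    [Module S M] : ℕ∞ :=
  ⨅ (n : ℕ) (_ : HasProjectiveDimensionLE (ModuleCat.of S M) n), (n : ℕ∞)

section Transpose

/- `D` is an `S`-`T`-bimodule (two commuting actions), and duality is `Hom_S(-, D)`, which takes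
`S`-modules to `T`-modules. Left modules over `R` are dualized with `S = R`, `T = Rᵐᵒᵖ`, `D = R`,
right modules over `R` with `S = Rᵐᵒᵖ`, `T = R`, `D = R`. -/
variable (S T : Type u) [Ring S] [Ring T] (D : Type u) [AddCommGroup D] [Module S D] [Module T D]
  [SMulCommClass S T D]

/-- The cokernel of `f^* : Hom_S(X₀, D) → Hom_S(X₁, D)`, for `f : X₁ → X₀`; a `T`-module. -/
abbrev CokerDual {X₁ X₀ : Type u} [AddCommGroup X₁] [Module S X₁] [AddCommGroup X₀] [Module S X₀]
    (f : X₁ →ₗ[S] X₀) : Type u :=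
  (X₁ →ₗ[S] D) ⧸ LinearMap.range (LinearMap.lcomp T D f)

variable (A : Type u) [AddCommGroup A] [Module S A] (M : Type u) [AddCommGroup M] [Module T M]

/-- `M` is (isomorphic to) the cokernel of `f^*` for some exact sequence `P₁ → P₀ → A → 0`
of `S`-modules, with first map `f` and `P₁`, `P₀` finitely generated projective. -/
def IsTransposeWith : Prop :=
  ∃ (P₁ P₀ : ModuleCat.{u} S) (f : P₁ →ₗ[S] P₀) (p : P₀ →ₗ[S] A),
    Module.Finite S P₁ ∧ Module.Finite S P₀ ∧
    Module.Projective S P₁ ∧ Module.Projective S P₀ ∧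
    Function.Exact f p ∧ Function.Surjective p ∧
    Nonempty (M ≃ₗ[T] CokerDual S T D f)

/-- `M` is (isomorphic to) the cokernel of `g^*` for some exact sequence `X₁ → X₀ → A → 0`
of `S`-modules, with first map `g` and `X₁`, `X₀` finitely generated Gorenstein projective. -/
def IsGorensteinTransposeWith : Prop :=
  ∃ (X₁ X₀ : ModuleCat.{u} S) (g : X₁ →ₗ[S] X₀) (p : X₀ →ₗ[S] A),
    Module.Finite S X₁ ∧ Module.Finite S X₀ ∧
    IsGorensteinProjective S X₁ ∧ IsGorensteinProjective S X₀ ∧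
    Function.Exact g p ∧ Function.Surjective p ∧
    Nonempty (M ≃ₗ[T] CokerDual S T D g)

end Transpose

/-- The right `R`-module `M` is a transpose of the left `R`-module `A`. -/
abbrev IsTranspose (R : Type u) [Ring R] (A : Type u) [AddCommGroup A] [Module R A]
    (M : Type u) [AddCommGroup M] [Module Rᵐᵒᵖ M] : Prop :=
  IsTransposeWith R Rᵐᵒᵖ R A M

/-- The left `R`-module `M` is a Gorenstein transpose of the right `R`-module `A`. -/
abbrev IsGorensteinTransposeOfRight (R : Type u) [Ring R] (A : Type u) [AddCommGroup A]
    [Module Rᵐᵒᵖ A] (M : Type u) [AddCommGroup M] [Module R M] : Prop :=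
  IsGorensteinTransposeWith Rᵐᵒᵖ R R A M

/-! Both conditions say that there is an exact sequence `0 → A → B → G → 0` with `B` finitely
generated, `pd B = n` and `G` Gorenstein projective. In such a sequence `Gpd A = pd B` as soon as
`pd B` is finite (`IsSES.gorensteinProjectiveDim_eq`): a finite projective dimension is detected by
Ext into projective modules, and there `G` contributes nothing in positive degrees. If `Gpd A` is
finite, the sequence exists by induction on syzygies (`HasGPDimLE.exists_embedding`).

From the sequence to transposes (`IsSES.exists_transpose`): for a projective cover `P₀ → B`, the
kernel `H` of `P₀ → G` is Gorenstein projective and maps onto `A`. Choose `P₁` covering the kernel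
of `H → A`; then `P₁ → P₀` presents `B` and `P₁ → H` presents `A`. Since `Ext¹(G, R) = 0`, the map
`P₀* → H*` is onto, so `H* → P₁*` presents `Tr B`; its dual has cokernel `A`, because `H` and `P₁`
are reflexive.

From transposes to the sequence (`IsDualizingPair.exists_embedding_of_transpose`): compare the
presentation `P₀* → P₁*` of `Tr B` with the Gorenstein one `X₁ → X₀`. Adding projective summands
makes the comparison onto in both degrees and between the kernels of the maps to `Tr B`. Dualizing,
`A` embeds in `B ⊕ (projective)` with Gorenstein projective cokernel, and the extra summand does not
change `pd B`. -/

/-- The sequence `0 → X → Y → Z → 0` given by `f` and `g` is exact. -/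
structure IsSES {S : Type u} [Ring S] {X Y Z : Type u} [AddCommGroup X] [AddCommGroup Y]
    [AddCommGroup Z] [Module S X] [Module S Y] [Module S Z]
    (f : X →ₗ[S] Y) (g : Y →ₗ[S] Z) : Prop where
  inj : Function.Injective f
  exact : Function.Exact f g
  surj : Function.Surjective g

/-- `Ext^i(X, Q) = 0`. -/
def ExtZero (S : Type u) [Ring S] (X Q : Type u) [AddCommGroup X] [Module S X]
    [AddCommGroup Q] [Module S Q] (i : ℕ) : Prop :=
  Subsingleton (Abelian.Ext.{u} (ModuleCat.of S X) (ModuleCat.of S Q) i)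

/-! ### Long exact sequences of Ext for short exact sequences of modules. -/

section

variable {S : Type u} [Ring S] {X Y Z Q : Type u} [AddCommGroup X] [AddCommGroup Y]
    [AddCommGroup Z] [AddCommGroup Q] [Module S X] [Module S Y] [Module S Z] [Module S Q]
    {f : X →ₗ[S] Y} {g : Y →ₗ[S] Z}

theorem extZero_iff {i : ℕ} : ExtZero S X Q i ↔
    ∀ x : Abelian.Ext.{u} (ModuleCat.of S X) (ModuleCat.of S Q) i, x = 0 :=
  subsingleton_iff_forall_eq 0

namespace IsSES

theorem ker {h : Y →ₗ[S] Z} (hh : Function.Surjective h) :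
    IsSES (LinearMap.ker h).subtype h :=
  ⟨Subtype.val_injective, LinearMap.exact_subtype_ker_map h, hh⟩

theorem range {h : X →ₗ[S] Y} (hh : Function.Injective h) :
    IsSES h (LinearMap.range h).mkQ :=
  ⟨hh, LinearMap.exact_map_mkQ_range h, Submodule.mkQ_surjective _⟩

theorem comp_eq_zero (h : IsSES f g) : g ∘ₗ f = 0 := LinearMap.ext h.exact.apply_apply_eq_zero

/-- A short exact sequence, as a short complex in the category of modules. -/
abbrev complex (h : IsSES f g) : ShortComplex (ModuleCat.{u} S) :=
  ModuleCat.shortComplexOfCompEqZero f g h.comp_eq_zero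

theorem shortExact (h : IsSES f g) : h.complex.ShortExact :=
  ModuleCat.shortComplex_shortExact _ h.exact h.inj h.surj

theorem exists_lift (h : IsSES f g) {W : Type u} [AddCommGroup W] [Module S W] (k : W →ₗ[S] Y)
    (hk : ∀ w, g (k w) = 0) : ∃ l : W →ₗ[S] X, ∀ w, f (l w) = k w := by
  have hr : ∀ w, k w ∈ LinearMap.range f := fun w => (h.exact (k w)).1 (hk w)
  refine ⟨(LinearEquiv.ofInjective f h.inj).symm.toLinearMap ∘ₗ k.codRestrict _ hr, fun w => ?_⟩
  have := LinearEquiv.apply_symm_apply (LinearEquiv.ofInjective f h.inj) (k.codRestrict _ hr w)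
  exact congrArg Subtype.val this

theorem extZero_mid (h : IsSES f g) {i : ℕ} (hX : ExtZero S X Q i) (hZ : ExtZero S Z Q i) :
    ExtZero S Y Q i := by
  rw [extZero_iff] at *
  intro x
  obtain ⟨y, hy⟩ := Abelian.Ext.contravariant_sequence_exact₂ h.shortExact _ x (hX _)
  rw [← hy, show y = 0 from hZ y, Abelian.Ext.comp_zero]

theorem extZero_left (h : IsSES f g) {i : ℕ} (hY : ExtZero S Y Q i)
    (hZ : ExtZero S Z Q (i + 1)) : ExtZero S X Q i := by
  rw [extZero_iff] at *
  intro x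
  obtain ⟨y, hy⟩ := Abelian.Ext.contravariant_sequence_exact₁ h.shortExact _ x (add_comm 1 i) (hZ _)
  rw [← hy, show y = 0 from hY y, Abelian.Ext.comp_zero]

theorem extZero_right (h : IsSES f g) {i : ℕ} (hX : ExtZero S X Q i)
    (hY : ExtZero S Y Q (i + 1)) : ExtZero S Z Q (i + 1) := by
  rw [extZero_iff] at *
  intro x
  obtain ⟨y, hy⟩ := Abelian.Ext.contravariant_sequence_exact₃ h.shortExact _ x (hY _) (add_comm 1 i)
  rw [← hy, show y = 0 from hX y, Abelian.Ext.comp_zero]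

/-- The obstruction to extending `φ` is its image under the connecting map to `Ext¹(Z, Q)`; `mk₀`
identifies `Ext⁰` with Hom. -/
theorem extend (h : IsSES f g) (hZ : ExtZero S Z Q 1) (φ : X →ₗ[S] Q) :
    ∃ ψ : Y →ₗ[S] Q, ψ ∘ₗ f = φ := by
  rw [extZero_iff] at hZ
  obtain ⟨y, hy⟩ := Abelian.Ext.contravariant_sequence_exact₁ h.shortExact _
    (Abelian.Ext.mk₀ (ModuleCat.ofHom φ)) (add_comm 1 0) (hZ _)
  obtain ⟨y, rfl⟩ := (Abelian.Ext.mk₀_bijective _ _).2 y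
  rw [Abelian.Ext.mk₀_comp_mk₀] at hy
  have := (Abelian.Ext.mk₀_bijective _ _).1 hy
  exact ⟨y.hom, congrArg ModuleCat.Hom.hom this⟩

/-- A converse to `extend`: each class in `Ext¹(Z, Q)` comes from a map `X → Q` by the connecting
map, which kills restrictions of maps from `Y`. -/
theorem extZero_one_right (h : IsSES f g) (hY : ExtZero S Y Q 1)
    (hX : ∀ φ : X →ₗ[S] Q, ∃ ψ : Y →ₗ[S] Q, ψ ∘ₗ f = φ) : ExtZero S Z Q 1 := by
  rw [extZero_iff] at *
  intro x
  obtain ⟨y, hy⟩ := Abelian.Ext.contravariant_sequence_exact₃ h.shortExact _ x (hY _) (add_comm 1 0)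
  obtain ⟨y, rfl⟩ := (Abelian.Ext.mk₀_bijective _ _).2 y
  obtain ⟨ψ, hψ⟩ := hX y.hom
  have : y = ModuleCat.ofHom f ≫ ModuleCat.ofHom ψ := by
    ext : 1
    exact hψ.symm
  rw [← hy, this, ← Abelian.Ext.mk₀_comp_mk₀]
  exact h.shortExact.extClass_comp_assoc _

theorem extZero_covariant (h : IsSES f g) {i : ℕ} (hY : ExtZero S Q Y i)
    (hX : ExtZero S Q X (i + 1)) : ExtZero S Q Z i := by
  rw [extZero_iff] at *
  intro x
  obtain ⟨y, hy⟩ := Abelian.Ext.covariant_sequence_exact₃ _ h.shortExact x rfl (hX _)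
  rw [← hy, show y = 0 from hY y, Abelian.Ext.zero_comp]

end IsSES

theorem extZero_of_projective (S : Type u) [Ring S] (X Q : Type u) [AddCommGroup X] [Module S X]
    [AddCommGroup Q] [Module S Q] [Module.Projective S X] (i : ℕ) : ExtZero S X Q (i + 1) := by
  have := (IsProjective.iff_projective (R := S) X).1 inferInstance
  exact HasProjectiveDimensionLT.subsingleton _ 1 _ (by omega) _

theorem hasProjectiveDimensionLE_iff_extZero {n : ℕ} :
    HasProjectiveDimensionLE (ModuleCat.of S X) n ↔
      ∀ (i : ℕ) (_ : n < i) (Q : ModuleCat.{u} S), ExtZero S X Q i := by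
  rw [HasProjectiveDimensionLE, hasProjectiveDimensionLT_iff]
  exact ⟨fun h i hi Q => extZero_iff.2 fun x => h i hi x,
    fun h i hi Q => extZero_iff.1 (h i hi Q)⟩

theorem exists_projective_cover (S : Type u) [Ring S] (X : Type u) [AddCommGroup X] [Module S X] :
    ∃ (F : ModuleCat.{u} S) (g : F →ₗ[S] X), Module.Projective S F ∧ Function.Surjective g :=
  ⟨ModuleCat.of S (X →₀ S), Finsupp.linearCombination S id,
    inferInstanceAs (Module.Projective S (X →₀ S)), Finsupp.linearCombination_id_surjective S X⟩

theorem exists_finite_projective_cover (S : Type u) [Ring S] (X : Type u) [AddCommGroup X] [Module S X]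
    [Module.Finite S X] :
    ∃ (F : ModuleCat.{u} S) (g : F →ₗ[S] X), Module.Finite S F ∧ Module.Projective S F ∧
      Function.Surjective g := by
  obtain ⟨n, g, hg⟩ := Module.Finite.exists_fin' S X
  exact ⟨ModuleCat.of S (Fin n → S), g, inferInstanceAs (Module.Finite S (Fin n → S)),
    inferInstanceAs (Module.Projective S (Fin n → S)), hg⟩

/-- If the projective dimension of `X` is finite, then it is detected by the functors
`Ext^i(X, -)` on projective modules. -/
theorem hasProjectiveDimensionLE_of_extZero_projective {m N : ℕ}
    (hN : HasProjectiveDimensionLE (ModuleCat.of S X) N)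
    (h : ∀ (i : ℕ) (_ : m < i) (Q : ModuleCat.{u} S), Module.Projective S Q → ExtZero S X Q i) :
    HasProjectiveDimensionLE (ModuleCat.of S X) m := by
  induction N with
  | zero => exact hasProjectiveDimensionLT_of_ge _ _ _ (show 0 + 1 ≤ m + 1 by omega)
  | succ N ih =>
    by_cases hm : m ≤ N
    · refine ih (hasProjectiveDimensionLE_iff_extZero.2 fun i hi Q => ?_)
      -- `Ext^i(X, Q)` lies between `Ext^i(X, F)`, zero by `h`, and `Ext^(i+1)(X, ker g)`, zero by
      -- `hN`.
      obtain ⟨F, g, hF, hg⟩ := exists_projective_cover S Q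
      exact (IsSES.ker hg).extZero_covariant (h i (by omega) F hF)
        (hasProjectiveDimensionLE_iff_extZero.1 hN (i + 1) (by omega) (ModuleCat.of S _))
    · exact hasProjectiveDimensionLT_of_ge _ _ _ (show N + 1 + 1 ≤ m + 1 by omega)

end

/-! ### Complete resolutions as chains of short exact sequences. -/

/-- There is an exact sequence `0 → X → P → Y → 0` with `P` projective, such that all maps from `X`
to projective modules extend to `P`. -/
def GPStep (S : Type u) [Ring S] (X Y : Type u) [AddCommGroup X] [AddCommGroup Y] [Module S X]
    [Module S Y] : Prop :=
  ∃ (P : ModuleCat.{u} S) (ι : X →ₗ[S] P) (π : P →ₗ[S] Y), Module.Projective S P ∧ IsSES ι π ∧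
    ∀ Q : ModuleCat.{u} S, Module.Projective S Q → ∀ φ : X →ₗ[S] Q, ∃ ψ : P →ₗ[S] Q, ψ ∘ₗ ι = φ

/-- All `Ext^i(X, Q)` with `i > 0` and `Q` projective vanish. -/
def ExtAcyclic (S : Type u) [Ring S] (X : Type u) [AddCommGroup X] [Module S X] : Prop :=
  ∀ Q : ModuleCat.{u} S, Module.Projective S Q → ∀ i, ExtZero S X Q (i + 1)

section

variable {S : Type u} [Ring S] {X Y Z : Type u} [AddCommGroup X] [AddCommGroup Y]
    [AddCommGroup Z] [Module S X] [Module S Y] [Module S Z] {f : X →ₗ[S] Y} {g : Y →ₗ[S] Z}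

theorem ExtZero.of_equiv {Q : Type u} [AddCommGroup Q] [Module S Q] {i : ℕ}
    (h : ExtZero S X Q (i + 1)) (e : X ≃ₗ[S] Y) : ExtZero S Y Q (i + 1) := by
  have : IsSES e.toLinearMap (0 : Y →ₗ[S] PUnit.{u + 1}) :=
    ⟨e.injective, fun y => ⟨fun _ => ⟨e.symm y, by simp⟩, fun _ => rfl⟩,
      fun z => ⟨0, Subsingleton.elim _ _⟩⟩
  exact this.extZero_mid h (extZero_of_projective S _ _ _)

theorem ExtAcyclic.of_projective [Module.Projective S X] : ExtAcyclic S X :=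
  fun _ _ _ => extZero_of_projective S _ _ _

namespace IsSES

theorem extAcyclic_mid (h : IsSES f g) (hX : ExtAcyclic S X) (hZ : ExtAcyclic S Z) :
    ExtAcyclic S Y := fun Q hQ i => h.extZero_mid (hX Q hQ i) (hZ Q hQ i)

theorem extAcyclic_left (h : IsSES f g) (hY : ExtAcyclic S Y) (hZ : ExtAcyclic S Z) :
    ExtAcyclic S X := fun Q hQ i => h.extZero_left (hY Q hQ i) (hZ Q hQ (i + 1))

theorem equiv_left (h : IsSES f g) {X' : Type u} [AddCommGroup X'] [Module S X']
    (e : X' ≃ₗ[S] X) : IsSES (f ∘ₗ e.toLinearMap) g :=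
  ⟨h.inj.comp e.injective, fun y => by
    rw [h.exact y]
    constructor
    · rintro ⟨x, rfl⟩
      exact ⟨e.symm x, by simp⟩
    · rintro ⟨x, rfl⟩
      exact ⟨e x, rfl⟩, h.surj⟩

end IsSES

theorem IsGorensteinProjective.of_equiv (h : IsGorensteinProjective S X) (e : X ≃ₗ[S] Y) :
    IsGorensteinProjective S Y := by
  obtain ⟨P, d, h1, h2, h3, ⟨k⟩⟩ := h
  exact ⟨P, d, h1, h2, h3, ⟨e.symm.trans k⟩⟩

/-- Cut the complete resolution at the images of its differentials; exactness of its dual becomes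
the extension property in `GPStep`. -/
theorem IsGorensteinProjective.exists_chain (h : IsGorensteinProjective S X) :
    ∃ G : ℤ → ModuleCat.{u} S, (∀ i, GPStep S (G i) (G (i + 1))) ∧ Nonempty (X ≃ₗ[S] G 0) := by
  obtain ⟨P, d, h1, h2, h3, ⟨k⟩⟩ := h
  refine ⟨fun i => ModuleCat.of S (LinearMap.range (d i)), fun i => ?_, ⟨k⟩⟩
  refine ⟨P (i + 1), (LinearMap.range (d i)).subtype, (d (i + 1)).rangeRestrict, h1 _,
    ⟨Subtype.val_injective, fun y => ?_, LinearMap.surjective_rangeRestrict _⟩, fun Q hQ φ => ?_⟩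
  · rw [← Subtype.coe_inj]
    exact (h2 i y).trans ⟨fun ⟨x, hx⟩ => ⟨⟨y, x, hx⟩, rfl⟩, fun ⟨x, hx⟩ => hx ▸ x.2⟩
  · have hex : ∀ ψ : P i →ₗ[S] Q, (∀ x, d i x = 0 → ψ x = 0) →
        ∃ χ : P (i + 1) →ₗ[S] Q, χ ∘ₗ d i = ψ := by
      obtain ⟨j, rfl⟩ : ∃ j, i = j + 1 := ⟨i - 1, by ring⟩
      intro ψ hψ
      refine (h3 Q hQ j ψ).1 (LinearMap.ext fun x => hψ _ ((h2 j _).2 ⟨x, rfl⟩))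
    obtain ⟨χ, hχ⟩ := hex (φ ∘ₗ (d i).rangeRestrict) (fun x hx => by
      have : (d i).rangeRestrict x = 0 := Subtype.ext hx
      simp [this])
    refine ⟨χ, LinearMap.ext ?_⟩
    rintro ⟨_, x, rfl⟩
    exact LinearMap.congr_fun hχ x

theorem isGorensteinProjective_of_chain (G : ℤ → ModuleCat.{u} S)
    (hG : ∀ i, GPStep S (G i) (G (i + 1))) (k : ℤ) (e : X ≃ₗ[S] G k) :
    IsGorensteinProjective S X := by
  -- In the spliced complex the image of `P 0 → P 1` is `G 1`, so the chain is shifted to move place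
  -- `k` to place `1`.
  obtain ⟨m, rfl⟩ : ∃ m, k = 1 + m := ⟨k - 1, by ring⟩
  obtain ⟨G, rfl⟩ : ∃ G' : ℤ → ModuleCat.{u} S, G = fun i => G' (i - m) :=
    ⟨fun i => G (i + m), by simp⟩
  replace hG : ∀ i, GPStep S (G i) (G (i + 1)) := fun i => by
    have := hG (i + m)
    beta_reduce at this
    rwa [add_sub_cancel_right, add_right_comm, add_sub_cancel_right] at this
  replace e : X ≃ₗ[S] G 1 := by
    beta_reduce at e
    rw [add_sub_cancel_right] at e
    exact e
  choose P ι π hP hses hext using hG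
  have hd : ∀ i x, ι (i + 1) (π i x) = 0 ↔ π i x = 0 := fun i x =>
    map_eq_zero_iff _ (hses (i + 1)).inj
  refine ⟨P, fun i => ι (i + 1) ∘ₗ π i, hP, fun i y => ?_, fun Q hQ i φ => ?_, ⟨?_⟩⟩
  · refine (hd (i + 1) y).trans (((hses (i + 1)).exact y).trans ?_)
    constructor
    · rintro ⟨x, rfl⟩
      obtain ⟨z, rfl⟩ := (hses i).surj x
      exact ⟨z, rfl⟩
    · rintro ⟨z, rfl⟩
      exact ⟨_, rfl⟩
  · constructor
    · intro hφ
      have hφ' : φ ∘ₗ ι (i + 1) = 0 := by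
        rw [← LinearMap.cancel_right (hses i).surj]
        exact hφ
      let ψ := (LinearMap.range (ι (i + 1))).liftQ φ (by
        rintro _ ⟨x, rfl⟩
        exact LinearMap.congr_fun hφ' x)
      let k : G (i + 1 + 1) →ₗ[S] Q :=
        ψ ∘ₗ (((hses (i + 1)).exact.linearEquivOfSurjective (hses (i + 1)).surj).symm.toLinearMap)
      have hk : ∀ x, k (π (i + 1) x) = φ x := by
        intro x
        have : ((hses (i + 1)).exact.linearEquivOfSurjective (hses (i + 1)).surj).symm
          (π (i + 1) x) = Submodule.Quotient.mk x := by
          rw [LinearEquiv.symm_apply_eq]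
          rfl
        simp [k, this, ψ]
      obtain ⟨χ, hχ⟩ := hext (i + 1 + 1) Q hQ k
      refine ⟨χ, LinearMap.ext fun x => ?_⟩
      rw [← hk]
      exact LinearMap.congr_fun hχ _
    · rintro ⟨χ, rfl⟩
      refine LinearMap.ext fun x => ?_
      have : π (i + 1) (ι (i + 1) (π i x)) = 0 := (hses (i + 1)).exact.apply_apply_eq_zero _
      simp [this]
  · rw [LinearMap.range_comp, LinearMap.range_eq_top.2 (hses 0).surj, Submodule.map_top]
    exact e.trans (LinearEquiv.ofInjective (ι (0 + 1)) (hses (0 + 1)).inj)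

theorem isGorensteinProjective_of_biclosed (C : ModuleCat.{u} S → Prop)
    (hs : ∀ G, C G → ∃ G', C G' ∧ GPStep S G G') (hp : ∀ G, C G → ∃ G', C G' ∧ GPStep S G' G)
    (h : C (ModuleCat.of S X)) : IsGorensteinProjective S X := by
  choose s hsC hs using hs
  choose p hpC hp using hp
  let s' : {G // C G} → {G // C G} := fun G => ⟨s G.1 G.2, hsC _ _⟩
  let p' : {G // C G} → {G // C G} := fun G => ⟨p G.1 G.2, hpC _ _⟩
  let c : ℤ → {G // C G} := fun i => match i with
    | Int.ofNat n => s'^[n] ⟨_, h⟩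
    | Int.negSucc n => p'^[n + 1] ⟨_, h⟩
  refine isGorensteinProjective_of_chain (fun i => (c i).1) ?_ 0 (LinearEquiv.refl S X)
  · rintro (n | n)
    · have : c (Int.ofNat n + 1) = s' (c (Int.ofNat n)) := Function.iterate_succ_apply' s' n _
      rw [this]
      exact hs _ _
    · have : c (Int.negSucc n) = p' (c (Int.negSucc n + 1)) := by
        cases n with
        | zero => rfl
        | succ n => exact Function.iterate_succ_apply' p' (n + 1) _
      rw [this]
      exact hp _ _

/-- Dimension shifting along the chain, at all places at once: degree `1` is the extension property,
and raising the degree moves one place to the left. -/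
theorem IsGorensteinProjective.extAcyclic (h : IsGorensteinProjective S X) : ExtAcyclic S X := by
  obtain ⟨G, hG, ⟨e⟩⟩ := h.exists_chain
  intro Q hQ i
  have key : ∀ j, ExtZero S (G (j + 1)) Q (i + 1) := by
    induction i with
    | zero =>
      intro j
      obtain ⟨P, ι, π, hP, hs, hx⟩ := hG j
      exact hs.extZero_one_right (extZero_of_projective S _ _ _) (hx Q hQ)
    | succ i ih =>
      intro j
      obtain ⟨P, ι, π, hP, hs, hx⟩ := hG j
      obtain ⟨j, rfl⟩ : ∃ k, j = k + 1 := ⟨j - 1, by ring⟩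
      exact hs.extZero_right (ih j) (extZero_of_projective S _ _ _)
  have := key (-1)
  rw [neg_add_cancel] at this
  exact this.of_equiv e.symm

theorem IsGorensteinProjective.exists_succ (h : IsGorensteinProjective S X) :
    ∃ (P G : ModuleCat.{u} S) (ι : X →ₗ[S] P) (π : P →ₗ[S] G), Module.Projective S P ∧
      IsSES ι π ∧ IsGorensteinProjective S G := by
  obtain ⟨G, hG, ⟨e⟩⟩ := h.exists_chain
  obtain ⟨P, ι, π, hP, hs, hx⟩ := hG 0
  refine ⟨P, G (0 + 1), ι ∘ₗ e.toLinearMap, π, hP, hs.equiv_left e, ?_⟩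
  exact isGorensteinProjective_of_chain G hG _ (LinearEquiv.refl _ _)

/-- The modules with a finite coresolution by projective modules that ends in a module in `C`. -/
inductive ProjCoresolved (C : ModuleCat.{u} S → Prop) : ModuleCat.{u} S → Prop
  | base (G : ModuleCat.{u} S) (h : C G) : ProjCoresolved C G
  | step (G P G' : ModuleCat.{u} S) (hP : Module.Projective S P) (ι : G →ₗ[S] P) (π : P →ₗ[S] G')
      (h : IsSES ι π) (h' : ProjCoresolved C G') : ProjCoresolved C G

/-- The criterion behind the closure properties below: only the right half of a complete resolution
has to stay in `C`. The left half comes from projective covers, whose kernels are `ProjCoresolved`,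
and Ext-acyclicity supplies the extension property. -/
theorem isGorensteinProjective_of_closed (C : ModuleCat.{u} S → Prop)
    (hE : ∀ G, C G → ExtAcyclic S G)
    (hs : ∀ G, C G → ∃ (P G' : ModuleCat.{u} S) (ι : G →ₗ[S] P) (π : P →ₗ[S] G'),
      Module.Projective S P ∧ IsSES ι π ∧ C G')
    (h : C (ModuleCat.of S X)) : IsGorensteinProjective S X := by
  have hE' : ∀ G, ProjCoresolved C G → ExtAcyclic S G := by
    intro G hG
    induction hG with
    | base G h => exact hE G h
    | step G P G' hP ι π h h' ih => exact h.extAcyclic_left .of_projective ih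
  have hstep : ∀ {G G' P : ModuleCat.{u} S} (_ : Module.Projective S P) {ι : G →ₗ[S] P}
      {π : P →ₗ[S] G'} (_ : IsSES ι π) (_ : ProjCoresolved C G'), GPStep S G G' :=
    fun {G G' P} hP ι π h h' => ⟨P, ι, π, hP, h, fun Q hQ φ => h.extend (hE' _ h' Q hQ 0) φ⟩
  refine isGorensteinProjective_of_biclosed (ProjCoresolved C) (fun G hG => ?_) (fun G hG => ?_)
    (.base _ h)
  · cases hG with
    | base _ h =>
      obtain ⟨P, G', ι, π, hP, hses, h'⟩ := hs G h
      exact ⟨G', .base _ h', hstep hP hses (.base _ h')⟩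
    | step _ P G' hP ι π h h' => exact ⟨G', h', hstep hP h h'⟩
  · obtain ⟨P, π, hP, hπ⟩ := exists_projective_cover S G
    exact ⟨ModuleCat.of S (LinearMap.ker π), .step _ P G hP _ π (IsSES.ker hπ) hG,
      hstep (G := ModuleCat.of S (LinearMap.ker π)) hP (IsSES.ker hπ) hG⟩

end

/-! ### Closure under extensions, kernels of surjections and direct summands. -/

section

variable {S : Type u} [Ring S] {X Y Z : Type u} [AddCommGroup X] [AddCommGroup Y]
    [AddCommGroup Z] [Module S X] [Module S Y] [Module S Z] {f : X →ₗ[S] Y} {g : Y →ₗ[S] Z}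

theorem IsSES.exists_desc (h : IsSES f g) {W : Type u} [AddCommGroup W] [Module S W]
    (k : Y →ₗ[S] W) (hk : ∀ x, k (f x) = 0) : ∃ l : Z →ₗ[S] W, ∀ y, l (g y) = k y := by
  let e := h.exact.linearEquivOfSurjective h.surj
  refine ⟨(LinearMap.range f).liftQ k (by rintro _ ⟨x, rfl⟩; exact hk x) ∘ₗ e.symm.toLinearMap,
    fun y => ?_⟩
  have : e.symm (g y) = Submodule.Quotient.mk y := by
    rw [LinearEquiv.symm_apply_eq]
    rfl
  simp [this]

theorem IsGorensteinProjective.of_projective (S : Type u) [Ring S] (X : Type u) [AddCommGroup X]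
    [Module S X] [h : Module.Projective S X] : IsGorensteinProjective S X := by
  refine isGorensteinProjective_of_closed (fun G => Module.Projective S G)
    (fun G hG => .of_projective) (fun G hG => ?_) h
  refine ⟨G, ModuleCat.of S PUnit.{u + 1}, LinearMap.id, 0, hG,
    ⟨fun _ _ h => h, fun y => ⟨fun _ => ⟨y, rfl⟩, fun _ => rfl⟩,
      fun z => ⟨0, Subsingleton.elim _ _⟩⟩, ?_⟩
  exact inferInstanceAs (Module.Projective S PUnit.{u + 1})

/-- Horseshoe argument: `ι : X → P` extends to `a : Y → P` since `Ext¹(Z, P) = 0`; then `(a, κ ∘ g)`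
embeds `Y` in `P × Q`, and its cokernel is an extension of `Z'` by `X'`. -/
theorem IsSES.isGorensteinProjective_mid (h : IsSES f g) (hX : IsGorensteinProjective S X)
    (hZ : IsGorensteinProjective S Z) : IsGorensteinProjective S Y := by
  refine isGorensteinProjective_of_closed (fun G => ∃ (X Z : ModuleCat.{u} S) (f : X →ₗ[S] G)
    (g : G →ₗ[S] Z), IsSES f g ∧ IsGorensteinProjective S X ∧ IsGorensteinProjective S Z) ?_ ?_
    ⟨ModuleCat.of S X, ModuleCat.of S Z, f, g, h, hX, hZ⟩
  · rintro G ⟨X, Z, f, g, h, hX, hZ⟩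
    exact h.extAcyclic_mid hX.extAcyclic hZ.extAcyclic
  · rintro G ⟨X, Z, f, g, h, hX, hZ⟩
    obtain ⟨P, X', ι, π, hP, hι, hX'⟩ := hX.exists_succ
    obtain ⟨Q, Z', κ, ρ, hQ, hκ, hZ'⟩ := hZ.exists_succ
    obtain ⟨a, ha⟩ := h.extend (hZ.extAcyclic P hP 0) ι
    replace ha : ∀ x, a (f x) = ι x := LinearMap.congr_fun ha
    have hinj : Function.Injective (a.prod (κ ∘ₗ g)) := by
      rw [injective_iff_map_eq_zero]
      intro y hy
      obtain ⟨h1, h2⟩ := Prod.ext_iff.1 hy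
      have h3 : g y = 0 := (map_eq_zero_iff κ hκ.inj).1 h2
      obtain ⟨x, rfl⟩ := (h.exact y).1 h3
      have h4 : ι x = 0 := (ha x).symm.trans h1
      rw [(map_eq_zero_iff ι hι.inj).1 h4, map_zero]
    have hq := IsSES.range hinj
    obtain ⟨u, hu⟩ := hι.exists_desc ((LinearMap.range (a.prod (κ ∘ₗ g))).mkQ ∘ₗ
      LinearMap.inl S P Q) (fun x => (hq.exact _).2 ⟨f x, Prod.ext (ha x) (by
        simp [h.exact.apply_apply_eq_zero])⟩)
    obtain ⟨v, hv⟩ := hq.exists_desc (ρ ∘ₗ LinearMap.snd S P Q)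
      (fun y => hκ.exact.apply_apply_eq_zero _)
    have huv : IsSES u v := by
      refine ⟨?_, fun w => ?_, fun z => ?_⟩
      · rw [injective_iff_map_eq_zero]
        intro x hx
        obtain ⟨p, rfl⟩ := hι.surj x
        rw [hu] at hx
        obtain ⟨y, hy⟩ := (hq.exact _).1 hx
        obtain ⟨h1, h2⟩ := Prod.ext_iff.1 hy
        obtain ⟨x, rfl⟩ := (h.exact y).1 ((map_eq_zero_iff κ hκ.inj).1 h2)
        exact (hι.exact p).2 ⟨x, (ha x).symm.trans h1⟩
      · obtain ⟨⟨p, q⟩, rfl⟩ := hq.surj w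
        rw [hv]
        constructor
        · intro h0
          obtain ⟨z, rfl⟩ := (hκ.exact q).1 h0
          obtain ⟨y, rfl⟩ := h.surj z
          refine ⟨π (p - a y), (hu _).trans ?_⟩
          rw [← sub_eq_zero, LinearMap.comp_apply, ← map_sub]
          exact (hq.exact _).2 ⟨-y, by ext <;> simp⟩
        · rintro ⟨x, hx⟩
          obtain ⟨p', rfl⟩ := hι.surj x
          rw [hu] at hx
          rw [← hv, ← hx, LinearMap.comp_apply, hv]
          simp
      · obtain ⟨q, rfl⟩ := hκ.surj z
        exact ⟨_, hv (0, q)⟩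
    exact ⟨ModuleCat.of S (P × Q), ModuleCat.of S (_ ⧸ LinearMap.range (a.prod (κ ∘ₗ g))), _, _,
      inferInstanceAs (Module.Projective S (P × Q)), hq, X', Z', u, v, huv, hX', hZ'⟩

theorem IsSES.isGorensteinProjective_of_projective_mid (h : IsSES f g) (hY : Module.Projective S Y)
    (hZ : IsGorensteinProjective S Z) : IsGorensteinProjective S X := by
  refine isGorensteinProjective_of_closed (fun G => ∃ (P Z : ModuleCat.{u} S) (f : G →ₗ[S] P)
    (g : P →ₗ[S] Z), Module.Projective S P ∧ IsSES f g ∧ IsGorensteinProjective S Z) ?_ ?_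
    ⟨ModuleCat.of S Y, ModuleCat.of S Z, f, g, hY, h, hZ⟩
  · rintro G ⟨P, Z, f, g, hP, h, hZ⟩
    exact h.extAcyclic_left .of_projective hZ.extAcyclic
  · rintro G ⟨P, Z, f, g, hP, h, hZ⟩
    obtain ⟨Q, Z', κ, ρ, hQ, hκ, hZ'⟩ := hZ.exists_succ
    exact ⟨P, Z, f, g, hP, h, Q, Z', κ, ρ, hQ, hκ, hZ'⟩

/-- Embed `Y` in a projective `P` with cokernel `Y'`. Then `P / X` is an extension of `Y'` by `Z`,
so `X` is the kernel of a map from a projective onto a Gorenstein projective module. -/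
theorem IsSES.isGorensteinProjective_left (h : IsSES f g) (hY : IsGorensteinProjective S Y)
    (hZ : IsGorensteinProjective S Z) : IsGorensteinProjective S X := by
  obtain ⟨P, Y', ι, π, hP, hι, hY'⟩ := hY.exists_succ
  have hq : IsSES (ι ∘ₗ f) _ := IsSES.range (hι.inj.comp h.inj)
  obtain ⟨u, hu⟩ := h.exists_desc ((LinearMap.range (ι ∘ₗ f)).mkQ ∘ₗ ι)
    (fun x => (hq.exact _).2 ⟨x, rfl⟩)
  obtain ⟨v, hv⟩ := hq.exists_desc π (fun x => hι.exact.apply_apply_eq_zero _)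
  have huv : IsSES u v := by
    refine ⟨?_, fun w => ?_, fun y => ?_⟩
    · rw [injective_iff_map_eq_zero]
      intro z hz
      obtain ⟨y, rfl⟩ := h.surj z
      rw [hu] at hz
      obtain ⟨x, hx⟩ := (hq.exact _).1 hz
      rw [← hι.inj hx, h.exact.apply_apply_eq_zero]
    · obtain ⟨p, rfl⟩ := hq.surj w
      rw [hv, hι.exact p]
      constructor
      · rintro ⟨y, rfl⟩
        exact ⟨g y, hu y⟩
      · rintro ⟨z, hz⟩
        obtain ⟨y, rfl⟩ := h.surj z
        rw [hu, LinearMap.comp_apply, ← sub_eq_zero, ← map_sub] at hz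
        obtain ⟨x, hx⟩ := (hq.exact _).1 hz
        refine ⟨y - f x, ?_⟩
        rw [LinearMap.comp_apply] at hx
        rw [map_sub, hx, sub_sub_cancel]
    · obtain ⟨p, rfl⟩ := hι.surj y
      exact ⟨_, hv p⟩
  exact hq.isGorensteinProjective_of_projective_mid hP (huv.isGorensteinProjective_mid hZ hY')

theorem IsSES.inl_snd (S : Type u) [Ring S] (X Y : Type u) [AddCommGroup X] [AddCommGroup Y]
    [Module S X] [Module S Y] : IsSES (LinearMap.inl S X Y) (LinearMap.snd S X Y) :=
  ⟨LinearMap.inl_injective, Function.Exact.inl_snd, LinearMap.snd_surjective⟩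

theorem IsGorensteinProjective.prod (hX : IsGorensteinProjective S X)
    (hY : IsGorensteinProjective S Y) : IsGorensteinProjective S (X × Y) :=
  (IsSES.inl_snd S X Y).isGorensteinProjective_mid hX hY

theorem ExtZero.of_retract {Q : Type u} [AddCommGroup Q] [Module S Q] {n : ℕ}
    (h : ExtZero S Y Q n) (i : X →ₗ[S] Y) (r : Y →ₗ[S] X) (hr : ∀ x, r (i x) = x) :
    ExtZero S X Q n := by
  rw [extZero_iff] at *
  intro x
  have h1 : ModuleCat.ofHom i ≫ ModuleCat.ofHom r = 𝟙 (ModuleCat.of S X) := by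
    ext x
    exact hr x
  rw [← Abelian.Ext.mk₀_id_comp x, ← h1, ← Abelian.Ext.mk₀_comp_mk₀_assoc,
    h ((Abelian.Ext.mk₀ (ModuleCat.ofHom r)).comp x (zero_add n)), Abelian.Ext.comp_zero]

/-- If `G` is a retract of `W`, embed `W` in `P` with cokernel `W'`. The cokernel `P / G` is again a
retract of a Gorenstein projective module, since `(P / G) × G` is an extension of `W'` by `W`. -/
theorem IsGorensteinProjective.of_retract (h : IsGorensteinProjective S Y) (i : X →ₗ[S] Y)
    (r : Y →ₗ[S] X) (hr : ∀ x, r (i x) = x) : IsGorensteinProjective S X := by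
  refine isGorensteinProjective_of_closed (fun G => ∃ (W : ModuleCat.{u} S) (i : G →ₗ[S] W)
    (r : W →ₗ[S] G), (∀ x, r (i x) = x) ∧ IsGorensteinProjective S W) ?_ ?_
    ⟨ModuleCat.of S Y, i, r, hr, h⟩
  · rintro G ⟨W, i, r, hr, hW⟩
    exact fun Q hQ n => (hW.extAcyclic Q hQ n).of_retract i r hr
  · rintro G ⟨W, i, r, hr, hW⟩
    obtain ⟨P, W', ι, π, hP, hι, hW'⟩ := hW.exists_succ
    have hi : Function.Injective i := Function.LeftInverse.injective hr
    have hq : IsSES (ι ∘ₗ i) _ := IsSES.range (hι.inj.comp hi)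
    obtain ⟨v, hv⟩ := hq.exists_desc π (fun x => hι.exact.apply_apply_eq_zero _)
    have huv : IsSES (((LinearMap.range (ι ∘ₗ i)).mkQ ∘ₗ ι).prod r)
        (v ∘ₗ LinearMap.fst S _ G) := by
      refine ⟨?_, ?_, fun w => ?_⟩
      · rw [injective_iff_map_eq_zero]
        intro w hw
        obtain ⟨h1, h2⟩ := Prod.ext_iff.1 hw
        obtain ⟨x, hx⟩ := (hq.exact _).1 h1
        have h3 : i x = w := hι.inj hx
        rw [← h3] at h2
        have h4 : x = 0 := (hr x).symm.trans h2
        rw [← h3, h4, map_zero]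
      · rintro ⟨w, x⟩
        obtain ⟨p, rfl⟩ := hq.surj w
        rw [LinearMap.comp_apply, LinearMap.fst_apply, hv, hι.exact p]
        constructor
        · rintro ⟨w, rfl⟩
          refine ⟨w + i (x - r w), Prod.ext ?_ (by simp [hr])⟩
          have : (LinearMap.range (ι ∘ₗ i)).mkQ (ι (i (x - r w))) = 0 :=
            (hq.exact _).2 ⟨_, rfl⟩
          simpa using this
        · rintro ⟨w, hw⟩
          have h1 : (LinearMap.range (ι ∘ₗ i)).mkQ (ι w) = (LinearMap.range (ι ∘ₗ i)).mkQ p :=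
            (Prod.ext_iff.1 hw).1
          rw [← sub_eq_zero, ← map_sub] at h1
          obtain ⟨x', hx⟩ := (hq.exact _).1 h1
          refine ⟨w - i x', ?_⟩
          rw [LinearMap.comp_apply] at hx
          rw [map_sub, hx, sub_sub_cancel]
      · obtain ⟨p, rfl⟩ := hι.surj w
        exact ⟨((LinearMap.range (ι ∘ₗ i)).mkQ p, 0), hv p⟩
    exact ⟨P, ModuleCat.of S (P ⧸ LinearMap.range (ι ∘ₗ i)), _, _, hP, hq,
      ModuleCat.of S ((P ⧸ LinearMap.range (ι ∘ₗ i)) × G), LinearMap.inl S _ G,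
      LinearMap.fst S _ G, fun _ => rfl, huv.isGorensteinProjective_mid hW hW'⟩

/-! ### Coresolutions by finitely generated projective modules. -/

/-- A finitely generated submodule of a free module lies in a finite coordinate submodule. -/
theorem exists_finset_mem_supported {ι : Type u} [Module.Finite S X] (j : X →ₗ[S] (ι →₀ S)) :
    ∃ t : Finset ι, ∀ x, j x ∈ Finsupp.supported S S (t : Set ι) := by
  classical
  obtain ⟨G, hG⟩ := Module.Finite.fg_top (R := S) (M := X)
  refine ⟨G.biUnion fun x => (j x).support, fun x => ?_⟩
  have : Submodule.span S (G : Set X) ≤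
      (Finsupp.supported S S ((G.biUnion fun x => (j x).support : Finset ι) : Set ι)).comap j := by
    rw [Submodule.span_le]
    intro y hy
    rw [SetLike.mem_coe, Submodule.mem_comap, Finsupp.mem_supported, Finset.coe_subset]
    exact Finset.subset_biUnion_of_mem (fun x => (j x).support) hy
  rw [hG] at this
  exact this trivial

/-- A map from a finitely generated module to a free module factors through a finitely generated
projective direct summand. -/
theorem exists_finite_summand {I : Type u} [Module.Finite S X] (j : X →ₗ[S] (I →₀ S)) :
    ∃ (P : ModuleCat.{u} S) (inc : P →ₗ[S] (I →₀ S)) (res : (I →₀ S) →ₗ[S] P),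
      Module.Finite S P ∧ Module.Projective S P ∧ (∀ a, res (inc a) = a) ∧
        ∀ x, inc (res (j x)) = j x := by
  obtain ⟨t, ht⟩ := exists_finset_mem_supported j
  classical
  have e := Finsupp.supportedEquivFinsupp (M := S) (R := S) (t : Set I)
  have hres : ∀ a : Finsupp.supported S S (t : Set I), Finsupp.restrictDom S S (t : Set I) a = a :=
    LinearMap.congr_fun (Finsupp.restrictDom_comp_subtype (M := S) (R := S) (t : Set I))
  exact ⟨ModuleCat.of S (Finsupp.supported S S (t : Set I)), (Finsupp.supported S S _).subtype,
    Finsupp.restrictDom S S (t : Set I), Module.Finite.equiv e.symm,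
    Module.Projective.of_equiv e.symm, hres, fun x => congrArg Subtype.val (hres ⟨j x, ht x⟩)⟩

/-- The projective `P` is a summand of a free module; its complement `ker r` is added to the
cokernel. Freeness gives the coordinates needed for a reduction to finite rank. -/
theorem IsGorensteinProjective.exists_free_succ (h : IsGorensteinProjective S X) :
    ∃ (ι : Type u) (G : ModuleCat.{u} S) (j : X →ₗ[S] (ι →₀ S)) (π : (ι →₀ S) →ₗ[S] G),
      IsSES j π ∧ IsGorensteinProjective S G := by
  obtain ⟨P, X', ι, π, hP, hι, hX'⟩ := h.exists_succ
  obtain ⟨s, hs⟩ := hP.out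
  let r : (P →₀ S) →ₗ[S] P := Finsupp.linearCombination S id
  have hr : ∀ p, r (s p) = p := hs
  let k : (P →₀ S) →ₗ[S] LinearMap.ker r :=
    (LinearMap.id - s ∘ₗ r).codRestrict (LinearMap.ker r) (fun a => by simp [hr])
  have hQ : Module.Projective S (LinearMap.ker r) := by
    refine Module.Projective.of_split (LinearMap.ker r).subtype k (LinearMap.ext fun a => ?_)
    have : r a = 0 := a.2
    exact Subtype.ext (by simp [k, this])
  refine ⟨P, ModuleCat.of S (X' × LinearMap.ker r), s ∘ₗ ι, (π ∘ₗ r).prod k,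
    ⟨(Function.LeftInverse.injective hr).comp hι.inj, fun a => ?_, ?_⟩,
    hX'.prod (.of_projective S _)⟩
  · constructor
    · intro ha
      obtain ⟨h1, h2⟩ := Prod.ext_iff.1 ha
      obtain ⟨x, hx⟩ := (hι.exact _).1 h1
      have h3 : a - s (r a) = 0 := congrArg Subtype.val h2
      exact ⟨x, by rw [LinearMap.comp_apply, hx, eq_comm, ← sub_eq_zero, h3]⟩
    · rintro ⟨x, rfl⟩
      refine Prod.ext ?_ (Subtype.ext ?_)
      · simp [hr, hι.exact.apply_apply_eq_zero]
      · simp [hr, k]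
  · rintro ⟨x', q⟩
    obtain ⟨p, rfl⟩ := hι.surj x'
    have hq : r q = 0 := q.2
    exact ⟨s p + q, Prod.ext (by simp [hr, hq]) (Subtype.ext (by simp [k, hr, hq]))⟩

/-- The image of `X` lies in a finite summand `P` of the free module, and `P / X` is a retract of
the Gorenstein projective cokernel `G`. -/
theorem IsGorensteinProjective.exists_finite_succ [Module.Finite S X]
    (h : IsGorensteinProjective S X) :
    ∃ (P G : ModuleCat.{u} S) (ι : X →ₗ[S] P) (π : P →ₗ[S] G), Module.Finite S P ∧
      Module.Projective S P ∧ Module.Finite S G ∧ IsSES ι π ∧ IsGorensteinProjective S G := by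
  obtain ⟨I, G, j, π, hj, hG⟩ := h.exists_free_succ
  obtain ⟨P, inc, res, hfin, hproj, hres, hj'⟩ := exists_finite_summand j
  have hinj : Function.Injective (res ∘ₗ j) := fun x y hxy => hj.inj (by
    rw [← hj' x, ← hj' y]
    exact congrArg inc hxy)
  have hq := IsSES.range hinj
  obtain ⟨i, hi⟩ := hq.exists_desc (π ∘ₗ inc) (fun x => by
    simp [hj', hj.exact.apply_apply_eq_zero])
  obtain ⟨r, hr⟩ := hj.exists_desc ((LinearMap.range (res ∘ₗ j)).mkQ ∘ₗ res)
    (fun x => (hq.exact _).2 ⟨x, rfl⟩)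
  refine ⟨P, ModuleCat.of S (_ ⧸ LinearMap.range (res ∘ₗ j)), res ∘ₗ j, _, hfin, hproj,
    Module.Finite.of_surjective _ hq.surj, hq, hG.of_retract i r fun w => ?_⟩
  obtain ⟨a, rfl⟩ := hq.surj w
  rw [hi, LinearMap.comp_apply, hr, LinearMap.comp_apply, hres]

end

/-! ### Gorenstein projective dimension through syzygies. -/

/-- There is an exact sequence `0 → G_n → ⋯ → G_0 → M → 0` with Gorenstein projective `G_i`,
in terms of iterated syzygies. -/
def HasGPDimLE (S : Type u) [Ring S] : ℕ → ModuleCat.{u} S → Prop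
  | 0, M => IsGorensteinProjective S M
  | n + 1, M => ∃ (K G : ModuleCat.{u} S) (ι : K →ₗ[S] G) (π : G →ₗ[S] M), IsSES ι π ∧
      IsGorensteinProjective S G ∧ HasGPDimLE S n K

section

variable {S : Type u} [Ring S] {X Y Z : Type u} [AddCommGroup X] [AddCommGroup Y]
    [AddCommGroup Z] [Module S X] [Module S Y] [Module S Z] {f : X →ₗ[S] Y} {g : Y →ₗ[S] Z}

theorem IsSES.zero_id (S : Type u) [Ring S] (X : Type u) [AddCommGroup X] [Module S X] :
    IsSES (0 : PUnit.{u + 1} →ₗ[S] X) LinearMap.id :=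
  ⟨fun _ _ _ => Subsingleton.elim _ _, fun _ => ⟨fun h => ⟨0, h.symm⟩, fun ⟨_, h⟩ => h.symm⟩,
    Function.surjective_id⟩

theorem HasGPDimLE.succ {n : ℕ} {M : ModuleCat.{u} S} (h : HasGPDimLE S n M) :
    HasGPDimLE S (n + 1) M := by
  induction n generalizing M with
  | zero =>
    exact ⟨ModuleCat.of S PUnit, M, 0, LinearMap.id, IsSES.zero_id S M, h,
      IsGorensteinProjective.of_projective S PUnit⟩
  | succ n ih =>
    obtain ⟨K, G, ι, π, hs, hG, hK⟩ := h
    exact ⟨K, G, ι, π, hs, hG, ih hK⟩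

theorem HasGPDimLE.mono {n m : ℕ} {M : ModuleCat.{u} S} (h : HasGPDimLE S n M) (hnm : n ≤ m) :
    HasGPDimLE S m M := by
  induction hnm with
  | refl => exact h
  | step _ ih => exact ih.succ

/-- Replace the first term `H` of a resolution of `Y` by the kernel of `H → Y → Z`, keeping the
syzygy `L`. -/
theorem IsSES.hasGPDimLE_left (h : IsSES f g) {n : ℕ} (hY : HasGPDimLE S n (ModuleCat.of S Y))
    (hZ : IsGorensteinProjective S Z) : HasGPDimLE S n (ModuleCat.of S X) := by
  cases n with
  | zero => exact h.isGorensteinProjective_left hY hZ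
  | succ n =>
    obtain ⟨L, H, ι, π, hs, hH, hL⟩ := hY
    have hker := IsSES.ker (h := g ∘ₗ π) (h.surj.comp hs.surj)
    have h0 : ∀ x, π (ι x) = 0 := hs.exact.apply_apply_eq_zero
    obtain ⟨ρ, hρ⟩ := h.exists_lift (π ∘ₗ (LinearMap.ker (g ∘ₗ π)).subtype) (fun w => w.2)
    refine ⟨L, ModuleCat.of S (LinearMap.ker (g ∘ₗ π)), ι.codRestrict _ (fun x => by simp [h0]), ρ,
      ⟨fun x y hxy => hs.inj (congrArg Subtype.val hxy), fun y => ?_, fun x => ?_⟩,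
      hker.isGorensteinProjective_left hH hZ, hL⟩
    · rw [← map_eq_zero_iff f h.inj, hρ]
      refine (hs.exact _).trans ⟨fun ⟨x, hx⟩ => ⟨x, Subtype.ext hx⟩, ?_⟩
      rintro ⟨x, rfl⟩
      exact ⟨x, rfl⟩
    · obtain ⟨y, hy⟩ := hs.surj (f x)
      refine ⟨⟨y, ?_⟩, h.inj ?_⟩
      · rw [LinearMap.mem_ker, LinearMap.comp_apply, hy, h.exact.apply_apply_eq_zero]
      · rw [hρ]
        exact hy

theorem HasGPDimLE.prod {n : ℕ} (hX : HasGPDimLE S n (ModuleCat.of S X))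
    (hY : IsGorensteinProjective S Y) : HasGPDimLE S n (ModuleCat.of S (X × Y)) := by
  cases n with
  | zero => exact IsGorensteinProjective.prod hX hY
  | succ n =>
    obtain ⟨L, H, ι, π, hs, hH, hL⟩ := hX
    refine ⟨L, ModuleCat.of S (H × Y), LinearMap.inl S H Y ∘ₗ ι, π.prodMap LinearMap.id,
      ⟨LinearMap.inl_injective.comp hs.inj, ?_, hs.surj.prodMap Function.surjective_id⟩,
      hH.prod hY, hL⟩
    rintro ⟨a, y⟩
    constructor
    · intro h
      obtain ⟨h1, h2⟩ := Prod.ext_iff.1 h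
      obtain ⟨l, rfl⟩ := (hs.exact a).1 h1
      exact ⟨l, Prod.ext rfl h2.symm⟩
    · rintro ⟨l, hl⟩
      rw [← hl]
      exact Prod.ext (hs.exact.apply_apply_eq_zero l) rfl

/-- As in Schanuel's lemma: a lift `s : Y → G` of `g` gives `0 → X → K × Y → G → 0`, where `K × Y`
has dimension at most `n`. -/
theorem IsSES.hasGPDimLE_syzygy (h : IsSES f g) (hY : Module.Projective S Y) {n : ℕ}
    (hZ : HasGPDimLE S (n + 1) (ModuleCat.of S Z)) : HasGPDimLE S n (ModuleCat.of S X) := by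
  obtain ⟨K, G, ι, π, hs, hG, hK⟩ := hZ
  obtain ⟨s, hsec⟩ := Module.projective_lifting_property π g hs.surj
  replace hsec : ∀ y, π (s y) = g y := LinearMap.congr_fun hsec
  obtain ⟨k, hk⟩ := hs.exists_lift (s ∘ₗ f) (fun x => by
    rw [LinearMap.comp_apply, hsec, h.exact.apply_apply_eq_zero])
  have hπι : ∀ x, π (ι x) = 0 := hs.exact.apply_apply_eq_zero
  have key : IsSES ((-k).prod f) (ι.coprod s) := by
    refine ⟨fun x y hxy => h.inj (Prod.ext_iff.1 hxy).2, ?_, fun a => ?_⟩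
    · rintro ⟨a, y⟩
      constructor
      · intro h0
        rw [LinearMap.coprod_apply] at h0
        have h1 : g y = 0 := by
          have := congrArg π h0
          rwa [map_add, hπι, zero_add, map_zero, hsec] at this
        obtain ⟨x, rfl⟩ := (h.exact y).1 h1
        refine ⟨x, Prod.ext (hs.inj ?_) rfl⟩
        change ι (-(k x)) = ι a
        rw [map_neg, hk]
        exact (eq_neg_of_add_eq_zero_left h0).symm
      · rintro ⟨x, hx⟩
        rw [← hx, LinearMap.coprod_apply]
        change ι (-(k x)) + s (f x) = 0
        rw [map_neg, hk, LinearMap.comp_apply, neg_add_cancel]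
    · obtain ⟨y, hy⟩ := h.surj (π a)
      obtain ⟨b, hb⟩ := (hs.exact (a - s y)).1 (by rw [map_sub, hsec, hy, sub_self])
      exact ⟨(b, y), by rw [LinearMap.coprod_apply, hb, sub_add_cancel]⟩
  exact key.hasGPDimLE_left (HasGPDimLE.prod (X := K) hK (.of_projective S Y)) hG

theorem HasGPDimLE.extZero {n : ℕ} {M : ModuleCat.{u} S} (h : HasGPDimLE S n M)
    {Q : ModuleCat.{u} S} (hQ : Module.Projective S Q) {i : ℕ} (hi : n < i) :
    ExtZero S M Q i := by
  obtain ⟨i, rfl⟩ : ∃ j, i = j + 1 := ⟨i - 1, by omega⟩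
  induction n generalizing M i with
  | zero => exact IsGorensteinProjective.extAcyclic h Q hQ i
  | succ n ih =>
    obtain ⟨K, G, ι, π, hs, hG, hK⟩ := h
    obtain ⟨i, rfl⟩ : ∃ j, i = j + 1 := ⟨i - 1, by omega⟩
    exact hs.extZero_right (ih hK _ (by omega)) (hG.extAcyclic Q hQ (i + 1))

theorem IsSES.hasProjectiveDimensionLE_left (h : IsSES f g) (hY : Module.Projective S Y) {n : ℕ}
    (hZ : HasProjectiveDimensionLE (ModuleCat.of S Z) (n + 1)) :
    HasProjectiveDimensionLE (ModuleCat.of S X) n :=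
  (h.shortExact.hasProjectiveDimensionLT_X₃_iff n ((IsProjective.iff_projective Y).1 hY)).1 hZ

theorem IsSES.hasProjectiveDimensionLE_right (h : IsSES f g) (hY : Module.Projective S Y) {n : ℕ}
    (hX : HasProjectiveDimensionLE (ModuleCat.of S X) n) :
    HasProjectiveDimensionLE (ModuleCat.of S Z) (n + 1) :=
  (h.shortExact.hasProjectiveDimensionLT_X₃_iff n ((IsProjective.iff_projective Y).1 hY)).2 hX

theorem hasProjectiveDimensionLE_zero_iff :
    HasProjectiveDimensionLE (ModuleCat.of S X) 0 ↔ Module.Projective S X :=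
  (CategoryTheory.projective_iff_hasProjectiveDimensionLE_zero _).symm.trans
    (IsProjective.iff_projective X).symm

theorem HasGPDimLE.of_hasProjectiveDimensionLE {n : ℕ} {M : ModuleCat.{u} S}
    (h : HasProjectiveDimensionLE M n) : HasGPDimLE S n M := by
  induction n generalizing M with
  | zero =>
    exact IsGorensteinProjective.of_projective S M (h := hasProjectiveDimensionLE_zero_iff.1 h)
  | succ n ih =>
    obtain ⟨F, π, hF, hπ⟩ := exists_projective_cover S M
    exact ⟨ModuleCat.of S (LinearMap.ker π), F, _, π, IsSES.ker hπ, .of_projective S F,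
      ih ((IsSES.ker hπ).hasProjectiveDimensionLE_left hF h)⟩

theorem hasGPDimLE_of_resolution {n : ℕ} {M : ModuleCat.{u} S}
    (h : HasGorensteinProjectiveResolution S M n) : HasGPDimLE S n M := by
  induction n generalizing M with
  | zero =>
    obtain ⟨G, d, ε, hG, h0, hε, hd, -⟩ := h
    have := h0 1 zero_lt_one
    refine (hG 0 le_rfl).of_equiv (LinearEquiv.ofBijective ε ⟨?_, hε⟩)
    rw [injective_iff_map_eq_zero]
    intro x hx
    obtain ⟨y, rfl⟩ := (hd x).1 hx
    rw [Subsingleton.elim y 0, map_zero]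
  | succ n ih =>
    obtain ⟨G, d, ε, hG, h0, hε, hd, hd'⟩ := h
    refine ⟨ModuleCat.of S (LinearMap.ker ε), G 0, _, ε, IsSES.ker hε, hG 0 (Nat.zero_le _), ih ?_⟩
    refine ⟨fun i => G (i + 1), fun i => d (i + 1),
      (d 0).codRestrict _ (fun x => hd.apply_apply_eq_zero x), fun i hi => hG _ (by omega),
      fun i hi => h0 _ (by omega), fun x => ?_, fun x => ?_, fun i => hd' (i + 1)⟩
    · obtain ⟨y, hy⟩ := (hd x.1).1 x.2
      exact ⟨y, Subtype.ext hy⟩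
    · rw [← hd' 0 x, Subtype.ext_iff]
      rfl

theorem HasGPDimLE.resolution {n : ℕ} {M : ModuleCat.{u} S} (h : HasGPDimLE S n M) :
    HasGorensteinProjectiveResolution S M n := by
  induction n generalizing M with
  | zero =>
    refine ⟨fun i => match i with | 0 => M | _ + 1 => ModuleCat.of S PUnit, fun i => 0,
      LinearMap.id, fun i hi => ?_, fun i hi => ?_, Function.surjective_id,
      (IsSES.zero_id S M).exact, fun i y => ?_⟩
    · obtain rfl : i = 0 := by omega
      exact h
    · obtain ⟨i, rfl⟩ : ∃ j, i = j + 1 := ⟨i - 1, by omega⟩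
      exact inferInstanceAs (Subsingleton PUnit)
    · exact ⟨fun _ => ⟨0, rfl⟩, fun _ => rfl⟩
  | succ n ih =>
    obtain ⟨K, G, ι, π, hs, hG, hK⟩ := h
    obtain ⟨G', d, ε, hG', h0, hε, hd, hd'⟩ := ih hK
    refine ⟨fun i => match i with | 0 => G | i + 1 => G' i, fun i => match i with
      | 0 => ι ∘ₗ ε | i + 1 => d i, π, fun i hi => ?_, fun i hi => ?_, hs.surj, fun y => ?_,
      fun i => ?_⟩
    · cases i with
      | zero => exact hG
      | succ i => exact hG' i (by omega)
    · cases i with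
      | zero => omega
      | succ i => exact h0 i (by omega)
    · rw [hs.exact y]
      constructor
      · rintro ⟨x, rfl⟩
        obtain ⟨z, rfl⟩ := hε x
        exact ⟨z, rfl⟩
      · rintro ⟨z, rfl⟩
        exact ⟨_, rfl⟩
    · cases i with
      | zero => exact fun y => (map_eq_zero_iff ι hs.inj).trans (hd y)
      | succ i => exact hd' i

theorem iInf_natCast_le_iff {p : ℕ → Prop} (hp : ∀ m n, m ≤ n → p m → p n) (m : ℕ) :
    (⨅ (n : ℕ) (_ : p n), (n : ℕ∞)) ≤ m ↔ p m := by
  refine ⟨fun h => ?_, fun h => iInf₂_le m h⟩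
  by_contra hm
  have : ((m + 1 : ℕ) : ℕ∞) ≤ ⨅ (n : ℕ) (_ : p n), (n : ℕ∞) := by
    refine le_iInf₂ fun n hn => Nat.cast_le.2 ?_
    by_contra hlt
    exact hm (hp n m (by omega) hn)
  have := Nat.cast_le.1 (this.trans h)
  omega

theorem gorensteinProjectiveDim_le_iff (M : ModuleCat.{u} S) (m : ℕ) :
    gorensteinProjectiveDim S M ≤ m ↔ HasGPDimLE S m M := by
  have h : ∀ n, HasGorensteinProjectiveResolution S M n ↔ HasGPDimLE S n M :=
    fun n => ⟨hasGPDimLE_of_resolution, fun h => h.resolution⟩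
  rw [gorensteinProjectiveDim, iInf_natCast_le_iff, h]
  intro a b hab
  rw [h, h]
  exact fun hm => hm.mono hab

theorem projectiveDim_le_iff (M : ModuleCat.{u} S) (m : ℕ) :
    projectiveDim S M ≤ m ↔ HasProjectiveDimensionLE M m :=
  iInf_natCast_le_iff (p := fun n => HasProjectiveDimensionLE M n)
    (fun a b hab h => hasProjectiveDimensionLT_of_ge _ (a + 1) (b + 1) (by omega)) m

theorem eq_of_forall_le_natCast_iff {a b : ℕ∞} (h : ∀ m : ℕ, a ≤ m ↔ b ≤ m) : a = b := by
  refine eq_of_forall_ge_iff fun c => ?_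
  induction c with
  | top => simp
  | coe m => exact h m

/-! ### Embeddings in modules of finite projective dimension. -/

/-- If `X` embeds in a module `Y` of finite projective dimension with Gorenstein projective
cokernel, then the Gorenstein projective dimension of `X` is the projective dimension of `Y`. -/
theorem IsSES.gorensteinProjectiveDim_eq (h : IsSES f g) (hZ : IsGorensteinProjective S Z) {N : ℕ}
    (hY : projectiveDim S Y ≤ N) : gorensteinProjectiveDim S X = projectiveDim S Y := by
  rw [projectiveDim_le_iff (ModuleCat.of S Y)] at hY
  refine eq_of_forall_le_natCast_iff fun m => ?_
  rw [gorensteinProjectiveDim_le_iff (ModuleCat.of S X), projectiveDim_le_iff (ModuleCat.of S Y)]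
  refine ⟨fun hX => ?_, fun hm => h.hasGPDimLE_left (.of_hasProjectiveDimensionLE hm) hZ⟩
  -- As `pd Y` is finite, only Ext into projective modules matters; there both `X` and `Z` vanish
  -- above degree `m`.
  refine hasProjectiveDimensionLE_of_extZero_projective hY fun i hi Q hQ => ?_
  obtain ⟨j, rfl⟩ : ∃ j, i = j + 1 := ⟨i - 1, by omega⟩
  exact h.extZero_mid (hX.extZero hQ hi) (hZ.extAcyclic Q hQ j)

/-- A finitely generated module of Gorenstein projective dimension at most `n` embeds in a finitely
generated module of projective dimension at most `n` with Gorenstein projective cokernel. -/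
theorem HasGPDimLE.exists_embedding [IsNoetherianRing S] {n : ℕ} {M : ModuleCat.{u} S}
    [Module.Finite S M] (h : HasGPDimLE S n M) :
    ∃ (B G : ModuleCat.{u} S) (ι : M →ₗ[S] B) (π : B →ₗ[S] G), IsSES ι π ∧ Module.Finite S B ∧
      IsGorensteinProjective S G ∧ HasProjectiveDimensionLE B n := by
  induction n generalizing M with
  | zero =>
    obtain ⟨P, G, ι, π, hPf, hP, -, hs, hG⟩ := IsGorensteinProjective.exists_finite_succ h
    exact ⟨P, G, ι, π, hs, hPf, hG, hasProjectiveDimensionLE_zero_iff.2 hP⟩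
  | succ n ih =>
    obtain ⟨P, q, hPf, hP, hq⟩ := exists_finite_projective_cover S M
    have hK := (IsSES.ker hq).hasGPDimLE_syzygy hP h
    obtain ⟨B, G, ι, π, hs, hB, hG, hpd⟩ := ih hK
    -- the pushout `D` of `P` and `B` along the kernel of `q`
    let K := LinearMap.ker q
    let j : K →ₗ[S] P × B := K.subtype.prod (-ι)
    have hj : Function.Injective j := fun x y hxy => Subtype.ext (Prod.ext_iff.1 hxy).1
    have hD := IsSES.range hj
    obtain ⟨v, hv⟩ := hD.exists_desc (π ∘ₗ LinearMap.snd S P B) (fun x => by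
      change π (-(ι x)) = 0
      rw [map_neg, hs.exact.apply_apply_eq_zero, neg_zero])
    obtain ⟨w, hw⟩ := hD.exists_desc (q ∘ₗ LinearMap.fst S P B) (fun x => x.2)
    have hj0 : ∀ x, (LinearMap.range j).mkQ (j x) = 0 := hD.exact.apply_apply_eq_zero
    have h1 : IsSES ((LinearMap.range j).mkQ ∘ₗ LinearMap.inl S P B) v := by
      refine ⟨?_, fun y => ?_, fun z => ?_⟩
      · rw [injective_iff_map_eq_zero]
        intro p hp
        obtain ⟨x, hx⟩ := (hD.exact _).1 hp
        obtain ⟨hx1, hx2⟩ := Prod.ext_iff.1 hx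
        have : x = 0 := hs.inj (by rw [map_zero]; exact neg_eq_zero.1 hx2)
        rw [this] at hx1
        exact hx1.symm
      · obtain ⟨⟨p, b⟩, rfl⟩ := hD.surj y
        rw [hv]
        constructor
        · intro hb
          obtain ⟨x, rfl⟩ := (hs.exact b).1 hb
          refine ⟨p + x, ?_⟩
          rw [← sub_eq_zero, LinearMap.comp_apply, ← map_sub, ← hj0 x]
          congr 1
          ext <;> simp [j]
        · rintro ⟨p', hp⟩
          rw [← hv, ← hp, LinearMap.comp_apply, hv]
          simp
      · obtain ⟨b, rfl⟩ := hs.surj z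
        exact ⟨_, hv (0, b)⟩
    have h2 : IsSES ((LinearMap.range j).mkQ ∘ₗ LinearMap.inr S P B) w := by
      refine ⟨?_, fun y => ?_, fun z => ?_⟩
      · rw [injective_iff_map_eq_zero]
        intro b hb
        obtain ⟨x, hx⟩ := (hD.exact _).1 hb
        obtain ⟨hx1, hx2⟩ := Prod.ext_iff.1 hx
        have : x = 0 := Subtype.ext hx1
        rw [this] at hx2
        rw [← show -(ι 0) = b from hx2, map_zero, neg_zero]
      · obtain ⟨⟨p, b⟩, rfl⟩ := hD.surj y
        rw [hw]
        constructor
        · intro hp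
          refine ⟨b + ι ⟨p, hp⟩, ?_⟩
          rw [eq_comm, ← sub_eq_zero, LinearMap.comp_apply, ← map_sub, ← hj0 ⟨p, hp⟩]
          congr 1
          ext <;> simp [j]
        · rintro ⟨b', hb⟩
          rw [← hw, ← hb, LinearMap.comp_apply, hw]
          simp
      · obtain ⟨p, rfl⟩ := hq z
        exact ⟨_, hw (p, 0)⟩
    -- The pushout is an extension of `G` by `P`, so it embeds in a finitely generated projective
    -- `F` with Gorenstein projective cokernel. It also contains `B` with quotient `M`, so `M`
    -- embeds in `F / B` with that same cokernel.
    have hDG := h1.isGorensteinProjective_mid (.of_projective S P) hG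
    have : Module.Finite S (P × B) := inferInstance
    have hDf : Module.Finite S ((P × B) ⧸ LinearMap.range j) := Module.Finite.of_surjective _ hD.surj
    obtain ⟨F, G', κ, ρ, hFf, hF, -, hκ, hG'⟩ := hDG.exists_finite_succ
    -- the quotient of `F` by `B`
    let c := κ ∘ₗ ((LinearMap.range j).mkQ ∘ₗ LinearMap.inr S P B)
    have hc : IsSES c _ := IsSES.range (hκ.inj.comp h2.inj)
    obtain ⟨a, ha⟩ := h2.exists_desc ((LinearMap.range c).mkQ ∘ₗ κ)
      (fun x => (hc.exact _).2 ⟨x, rfl⟩)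
    obtain ⟨r, hr⟩ := hc.exists_desc ρ (fun x => hκ.exact.apply_apply_eq_zero _)
    refine ⟨ModuleCat.of S (F ⧸ LinearMap.range c), G', a, r, ⟨?_, fun y => ?_, fun z => ?_⟩,
      Module.Finite.of_surjective _ hc.surj, hG', hc.hasProjectiveDimensionLE_right hF hpd⟩
    · rw [injective_iff_map_eq_zero]
      intro m hm
      obtain ⟨d, rfl⟩ := h2.surj m
      rw [ha] at hm
      obtain ⟨b, hb⟩ := (hc.exact _).1 hm
      rw [← hκ.inj hb, h2.exact.apply_apply_eq_zero]
    · obtain ⟨p, rfl⟩ := hc.surj y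
      rw [hr, hκ.exact p]
      constructor
      · rintro ⟨d, rfl⟩
        exact ⟨w d, ha d⟩
      · rintro ⟨m, hm⟩
        obtain ⟨d, rfl⟩ := h2.surj m
        rw [ha, LinearMap.comp_apply, ← sub_eq_zero, ← map_sub] at hm
        obtain ⟨x, hx⟩ := (hc.exact _).1 hm
        refine ⟨d - _, (map_sub κ _ _).trans (?_ : κ d - c x = p)⟩
        rw [hx, sub_sub_cancel]
    · obtain ⟨p, rfl⟩ := hκ.surj z
      exact ⟨_, hr p⟩

end

/-! ### Duality of finitely generated Gorenstein projective modules. -/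

/-- The bimodule `D` is free of rank one over both `S` and `T`, on the same generator. -/
def IsDualizingPair (S T D : Type u) [Ring S] [Ring T] [AddCommGroup D] [Module S D]
    [Module T D] : Prop :=
  ∃ e : D, Function.Bijective (fun s : S => s • e) ∧ Function.Bijective (fun t : T => t • e)

section

variable {S T D : Type u} [Ring S] [Ring T] [AddCommGroup D] [Module S D] [Module T D]

/-- This symmetry lets each result on duals serve for left and for right modules. -/
theorem IsDualizingPair.symm (h : IsDualizingPair S T D) : IsDualizingPair T S D :=
  let ⟨e, h1, h2⟩ := h
  ⟨e, h2, h1⟩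

theorem IsDualizingPair.nonempty_equiv (h : IsDualizingPair S T D) : Nonempty (S ≃ₗ[S] D) :=
  let ⟨e, h1, _⟩ := h
  ⟨LinearEquiv.ofBijective (LinearMap.toSpanSingleton S D e) h1⟩

theorem IsDualizingPair.projective (h : IsDualizingPair S T D) : Module.Projective S D :=
  let ⟨e⟩ := h.nonempty_equiv
  Module.Projective.of_equiv e

theorem IsDualizingPair.finite (h : IsDualizingPair S T D) : Module.Finite S D :=
  let ⟨e⟩ := h.nonempty_equiv
  Module.Finite.equiv e

variable {X Y Z : Type u} [AddCommGroup X] [AddCommGroup Y]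
    [AddCommGroup Z] [Module S X] [Module S Y] [Module S Z] {f : X →ₗ[S] Y} {g : Y →ₗ[S] Z}

theorem IsDualizingPair.extZero (h : IsDualizingPair S T D) (hX : ExtAcyclic S X) (i : ℕ) :
    ExtZero S X D (i + 1) :=
  hX (ModuleCat.of S D) h.projective i

/-- Embed `Q` in a free module: the image of `X` meets finitely many coordinates, and each
coordinate is a map to `S ≅ D`, which extends. -/
theorem IsDualizingPair.extend_projective (h : IsDualizingPair S T D) [Module.Finite S X]
    (hf : ∀ φ : X →ₗ[S] D, ∃ ψ : Y →ₗ[S] D, ψ ∘ₗ f = φ) {Q : Type u} [AddCommGroup Q] [Module S Q]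
    (hQ : Module.Projective S Q) (φ : X →ₗ[S] Q) : ∃ ψ : Y →ₗ[S] Q, ψ ∘ₗ f = φ := by
  classical
  obtain ⟨e⟩ := h.nonempty_equiv
  obtain ⟨s, hs⟩ := hQ.out
  obtain ⟨t, ht⟩ := exists_finset_mem_supported (s ∘ₗ φ)
  choose ψ hψ using fun q : Q => hf (e.toLinearMap ∘ₗ Finsupp.lapply q ∘ₗ s ∘ₗ φ)
  refine ⟨Finsupp.linearCombination S id ∘ₗ
    ∑ q ∈ t, Finsupp.lsingle q ∘ₗ e.symm.toLinearMap ∘ₗ ψ q, LinearMap.ext fun x => ?_⟩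
  have h1 : ∀ q, e.symm (ψ q (f x)) = s (φ x) q := fun q => by
    rw [LinearEquiv.symm_apply_eq]
    exact LinearMap.congr_fun (hψ q) x
  have h2 : ∑ q ∈ t, Finsupp.single q (s (φ x) q) = s (φ x) := by
    conv_rhs => rw [← Finsupp.sum_single (s (φ x))]
    exact (Finsupp.sum_of_support_subset _ (ht x) _ (fun q _ => Finsupp.single_zero q)).symm
  have h3 : (∑ q ∈ t, Finsupp.lsingle q ∘ₗ e.symm.toLinearMap ∘ₗ ψ q) (f x) = s (φ x) := by
    rw [← h2]
    simp [LinearMap.sum_apply, h1]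
  rw [LinearMap.comp_apply, LinearMap.comp_apply, h3]
  exact hs (φ x)

variable [SMulCommClass S T D] [SMulCommClass T S D]

variable (S T D X) in
/-- The evaluation map to the double dual. -/
def evalBidual : X →ₗ[S] ((X →ₗ[S] D) →ₗ[T] D) where
  toFun x :=
    { toFun := fun φ => φ x
      map_add' := fun _ _ => rfl
      map_smul' := fun _ _ => rfl }
  map_add' x y := LinearMap.ext fun φ => map_add φ x y
  map_smul' s x := LinearMap.ext fun φ => map_smul φ s x

@[simp]
theorem evalBidual_apply (x : X) (φ : X →ₗ[S] D) : evalBidual S T D X x φ = φ x := rfl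

theorem IsSES.dual (T : Type u) [Ring T] [Module T D] [SMulCommClass S T D] (h : IsSES f g)
    (hZ : ExtZero S Z D 1) : IsSES (LinearMap.lcomp T D g) (LinearMap.lcomp T D f) := by
  refine ⟨fun φ ψ hφψ => ?_, fun φ => ?_, fun φ => h.extend hZ φ⟩
  · exact (LinearMap.cancel_right h.surj).1 hφψ
  · constructor
    · intro hφ
      obtain ⟨l, hl⟩ := h.exists_desc φ (LinearMap.congr_fun hφ)
      exact ⟨l, LinearMap.ext hl⟩
    · rintro ⟨l, rfl⟩
      exact LinearMap.ext fun x => (congrArg l (h.exact.apply_apply_eq_zero x)).trans (map_zero l)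

theorem exists_finite_dual_basis (S : Type u) [Ring S] (P : Type u) [AddCommGroup P] [Module S P]
    [Module.Finite S P] [Module.Projective S P] :
    ∃ (n : ℕ) (i : P →ₗ[S] (Fin n → S)) (r : (Fin n → S) →ₗ[S] P), (∀ p, r (i p) = p) ∧
      ∀ c, r c = ∑ k, c k • r (Pi.single k 1) := by
  obtain ⟨n, r, hr⟩ := Module.Finite.exists_fin' S P
  obtain ⟨i, hi⟩ := Module.projective_lifting_property r LinearMap.id hr
  refine ⟨n, i, r, LinearMap.congr_fun hi, ?_⟩
  intro c
  rw [r.pi_apply_eq_sum_univ c]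
  refine Finset.sum_congr rfl fun k _ => congrArg (fun v => c k • r v) (funext fun j => ?_)
  rw [Pi.single_apply]
  exact if_congr eq_comm rfl rfl

/-- A finite dual basis of `X` makes its dual a retract of `D^n`, and `D` is free of rank one over
`T`. -/
theorem IsDualizingPair.finite_projective_dual (h : IsDualizingPair S T D)
    [Module.Finite S X] [Module.Projective S X] :
    Module.Finite T (X →ₗ[S] D) ∧ Module.Projective T (X →ₗ[S] D) := by
  obtain ⟨n, i, r, hir, hr⟩ := exists_finite_dual_basis S X
  have := h.symm.finite
  have := h.symm.projective
  let a : (X →ₗ[S] D) →ₗ[T] (Fin n → D) :=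
    LinearMap.pi fun k => evalBidual S T D X (r (Pi.single k 1))
  let b : (Fin n → D) →ₗ[T] (X →ₗ[S] D) :=
    { toFun := fun d =>
        { toFun := fun x => ∑ k, i x k • d k
          map_add' := fun x y => by simp [add_smul, Finset.sum_add_distrib]
          map_smul' := fun s x => by simp [mul_smul, Finset.smul_sum] }
      map_add' := fun d d' => by
        ext x
        simp [Finset.sum_add_distrib]
      map_smul' := fun t d => by
        ext x
        simp [Finset.smul_sum, smul_comm t] }
  have hab : ∀ φ, b (a φ) = φ := fun φ => LinearMap.ext fun x => by
    conv_rhs => rw [← hir x, hr, map_sum]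
    simp only [map_smul]
    rfl
  have : Module.Projective T (Fin n → D) :=
    Module.Projective.of_equiv (DFinsupp.linearEquivFunOnFintype (R := T) (M := fun _ : Fin n => D))
  exact ⟨Module.Finite.of_surjective b (Function.LeftInverse.surjective hab),
    Module.Projective.of_split a b (LinearMap.ext hab)⟩

theorem IsDualizingPair.finite_dual [IsNoetherianRing T] (h : IsDualizingPair S T D)
    [Module.Finite S X] : Module.Finite T (X →ₗ[S] D) := by
  obtain ⟨P, π, hPf, hP, hπ⟩ := exists_finite_projective_cover S X
  have := (h.finite_projective_dual (X := P)).1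
  exact Module.Finite.of_injective (LinearMap.lcomp T D π)
    fun φ ψ hφψ => (LinearMap.cancel_right hπ).1 hφψ

theorem IsDualizingPair.evalBidual_bijective_of_projective (h : IsDualizingPair S T D)
    [Module.Finite S X] [Module.Projective S X] :
    Function.Bijective (evalBidual S T D X) := by
  obtain ⟨n, i, r, hir, hr⟩ := exists_finite_dual_basis S X
  obtain ⟨e, hS, hT⟩ := h
  let ψ : Fin n → (X →ₗ[S] D) := fun k =>
    LinearMap.toSpanSingleton S D e ∘ₗ LinearMap.proj k ∘ₗ i
  have hψ : ∀ k x, ψ k x = i x k • e := fun k x => rfl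
  constructor
  · rw [injective_iff_map_eq_zero]
    intro x hx
    have : i x = 0 := funext fun k => hS.1 (by
      have := LinearMap.congr_fun hx (ψ k)
      simpa [hψ] using this)
    rw [← hir x, this, map_zero]
  · intro η
    choose s hs using fun k => hS.2 (η (ψ k))
    refine ⟨r s, LinearMap.ext fun φ => ?_⟩
    choose t ht using fun k => hT.2 (φ (r (Pi.single k 1)))
    have hφ : φ = ∑ k, t k • ψ k := by
      ext x
      rw [← hir x, hr, map_sum, LinearMap.sum_apply]
      refine Finset.sum_congr rfl fun k _ => ?_
      rw [map_smul, ← ht k, LinearMap.smul_apply, hψ, ← hr, hir, smul_comm]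
    have h1 : η φ = ∑ k, t k • s k • e := by
      conv_lhs => rw [hφ]
      rw [map_sum]
      refine Finset.sum_congr rfl fun k _ => ?_
      rw [map_smul]
      exact congrArg _ (hs k).symm
    rw [h1, evalBidual_apply, hr, map_sum]
    refine Finset.sum_congr rfl fun k _ => ?_
    rw [map_smul, ← ht k, smul_comm]

/-- Injectivity is inherited from a projective `P` containing `X`. For surjectivity, `η` gives a
functional on the dual of `P`, that is, some `p`; it dies in the torsionless module `Y = P / X`, so
it lies in `X`. Functionals on `X` extend to `P`, so `p` represents `η`. -/
theorem IsDualizingPair.evalBidual_bijective (h : IsDualizingPair S T D) [Module.Finite S X]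
    (hX : IsGorensteinProjective S X) : Function.Bijective (evalBidual S T D X) := by
  have hinj : ∀ (G : ModuleCat.{u} S), Module.Finite S G → IsGorensteinProjective S G →
      ∀ x : G, (∀ φ : G →ₗ[S] D, φ x = 0) → x = 0 := by
    intro G _ hG x hx
    obtain ⟨P, G', ι, π, hPf, hP, -, hs, hG'⟩ := hG.exists_finite_succ
    have := (h.evalBidual_bijective_of_projective (X := P)).1
    refine hs.inj (this (LinearMap.ext fun φ => ?_))
    rw [map_zero, map_zero]
    exact hx (φ ∘ₗ ι)
  refine ⟨(injective_iff_map_eq_zero _).2 fun x hx =>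
    hinj (ModuleCat.of S X) ‹_› hX x (LinearMap.congr_fun hx), fun η => ?_⟩
  obtain ⟨P, Y, ι, π, hPf, hP, hYf, hs, hY⟩ := hX.exists_finite_succ
  obtain ⟨p, hp⟩ := (h.evalBidual_bijective_of_projective (X := P)).2
    (η ∘ₗ LinearMap.lcomp T D ι)
  replace hp : ∀ φ : P →ₗ[S] D, φ p = η (φ ∘ₗ ι) := LinearMap.congr_fun hp
  have hπp : π p = 0 := hinj Y hYf hY _ fun φ => by
    have : (φ ∘ₗ π) ∘ₗ ι = 0 := by rw [LinearMap.comp_assoc, hs.comp_eq_zero, LinearMap.comp_zero]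
    rw [← LinearMap.comp_apply, hp, this, map_zero]
  obtain ⟨x, rfl⟩ := (hs.exact p).1 hπp
  refine ⟨x, LinearMap.ext fun φ => ?_⟩
  obtain ⟨ψ, rfl⟩ := hs.extend (h.extZero hY.extAcyclic 0) φ
  exact hp ψ

/-- The dual of a finitely generated Gorenstein projective module is Gorenstein projective. -/
theorem IsDualizingPair.isGorensteinProjective_dual [IsNoetherianRing S] [IsNoetherianRing T]
    (h : IsDualizingPair S T D) [Module.Finite S X] (hX : IsGorensteinProjective S X) :
    IsGorensteinProjective T (X →ₗ[S] D) := by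
  have hstep : ∀ (X P Y : ModuleCat.{u} S) (ι : X →ₗ[S] P) (π : P →ₗ[S] Y), IsSES ι π →
      Module.Finite S P → Module.Projective S P → IsGorensteinProjective S Y → Module.Finite S Y →
      GPStep T (Y →ₗ[S] D) (X →ₗ[S] D) := by
    intro X P Y ι π hs hPf hP hY hYf
    refine ⟨ModuleCat.of T (P →ₗ[S] D), LinearMap.lcomp T D π, LinearMap.lcomp T D ι,
      (h.finite_projective_dual (X := P)).2, hs.dual T (h.extZero hY.extAcyclic 0),
      fun Q hQ φ => ?_⟩
    have := h.finite_dual (X := Y)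
    -- By reflexivity a functional on the dual of `Y` is evaluation at some `y`; evaluation at a
    -- preimage `p` of `y` extends it.
    refine h.symm.extend_projective (fun η => ?_) hQ φ
    obtain ⟨y, rfl⟩ := (h.evalBidual_bijective hY).2 η
    obtain ⟨p, rfl⟩ := hs.surj y
    exact ⟨evalBidual S T D P p, rfl⟩
  -- Duality reverses arrows: syzygies of a module give successors of its dual, cosyzygies give
  -- predecessors.
  refine isGorensteinProjective_of_biclosed (fun W => ∃ X : ModuleCat.{u} S, Module.Finite S X ∧
    IsGorensteinProjective S X ∧ W = ModuleCat.of T (X →ₗ[S] D)) ?_ ?_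
    ⟨ModuleCat.of S X, ‹_›, hX, rfl⟩
  · rintro _ ⟨Y, hYf, hY, rfl⟩
    obtain ⟨P, π, hPf, hP, hπ⟩ := exists_finite_projective_cover S Y
    have hs := IsSES.ker hπ
    exact ⟨_, ⟨ModuleCat.of S (LinearMap.ker π), inferInstanceAs (Module.Finite S (LinearMap.ker π)),
      hs.isGorensteinProjective_left (.of_projective S P) hY, rfl⟩,
      hstep (ModuleCat.of S (LinearMap.ker π)) P Y _ _ hs hPf hP hY hYf⟩
  · rintro _ ⟨X, hXf, hX, rfl⟩
    obtain ⟨P, Y, ι, π, hPf, hP, hYf, hs, hY⟩ := hX.exists_finite_succ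
    exact ⟨_, ⟨Y, hYf, hY, rfl⟩, hstep X P Y ι π hs hPf hP hY hYf⟩

end

/-! ### Transposes and Gorenstein transposes. -/

section

variable {S T D : Type u} [Ring S] [Ring T] [AddCommGroup D] [Module S D] [Module T D]
  [SMulCommClass S T D] [SMulCommClass T S D]

/-- If `A` embeds in `B` with Gorenstein projective cokernel, then `A` is a Gorenstein transpose of
a transpose of `B`. -/
theorem IsSES.exists_transpose [IsNoetherianRing S] [IsNoetherianRing T]
    (h : IsDualizingPair S T D) {A B G : Type u} [AddCommGroup A] [AddCommGroup B] [AddCommGroup G]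
    [Module S A] [Module S B] [Module S G] [Module.Finite S B] {a : A →ₗ[S] B} {b : B →ₗ[S] G}
    (hs : IsSES a b) (hG : IsGorensteinProjective S G) :
    ∃ M : ModuleCat.{u} T, IsTransposeWith S T D B M ∧ IsGorensteinTransposeWith T S D M A := by
  obtain ⟨P₀, p, hP₀f, hP₀, hp⟩ := exists_finite_projective_cover S B
  have hker := IsSES.ker (h := b ∘ₗ p) (hs.surj.comp hp)
  have hH := hker.isGorensteinProjective_left (.of_projective S P₀) hG
  let H := LinearMap.ker (b ∘ₗ p)
  obtain ⟨ρ, hρ⟩ := hs.exists_lift (p ∘ₗ H.subtype) (fun x => x.2)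
  have hρs : Function.Surjective ρ := fun x => by
    obtain ⟨y, hy⟩ := hp (a x)
    refine ⟨⟨y, ?_⟩, hs.inj ((hρ _).trans hy)⟩
    rw [LinearMap.mem_ker, LinearMap.comp_apply, hy, hs.exact.apply_apply_eq_zero]
  obtain ⟨P₁, q, hP₁f, hP₁, hq⟩ := exists_finite_projective_cover S (LinearMap.ker ρ)
  let k : P₁ →ₗ[S] H := (LinearMap.ker ρ).subtype ∘ₗ q
  have hk : Function.Exact k ρ := fun x =>
    ⟨fun hx => (hq ⟨x, hx⟩).imp fun y hy => congrArg Subtype.val hy, by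
      rintro ⟨y, rfl⟩
      exact (q y).2⟩
  let f : P₁ →ₗ[S] P₀ := H.subtype ∘ₗ k
  have hf : Function.Exact f p := by
    intro y
    constructor
    · intro hy
      have hyH : y ∈ H := by rw [LinearMap.mem_ker, LinearMap.comp_apply, hy, map_zero]
      obtain ⟨x, hx⟩ := (hk ⟨y, hyH⟩).1 (hs.inj (by
        rw [hρ, map_zero]
        exact hy))
      exact ⟨x, congrArg Subtype.val hx⟩
    · rintro ⟨x, rfl⟩
      have : a (ρ (k x)) = p (f x) := hρ _
      rw [← this, hk.apply_apply_eq_zero, map_zero]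
  -- Restriction from `P₀` to `H` is onto on duals, so the duals of `f` and `k` have the same image.
  have hdual := hker.dual T (h.extZero hG.extAcyclic 0)
  refine ⟨ModuleCat.of T (CokerDual S T D f), ⟨P₁, P₀, f, p, hP₁f, hP₀f, hP₁, hP₀, hf, hp,
    ⟨LinearEquiv.refl _ _⟩⟩, ?_⟩
  have hP₁d := h.finite_projective_dual (X := P₁)
  refine ⟨ModuleCat.of T (H →ₗ[S] D), ModuleCat.of T (P₁ →ₗ[S] D), LinearMap.lcomp T D k,
    (LinearMap.range (LinearMap.lcomp T D f)).mkQ, h.finite_dual (X := H), hP₁d.1,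
    h.isGorensteinProjective_dual hH, .of_projective T _ (h := hP₁d.2), fun φ => ?_,
    Submodule.mkQ_surjective _, ⟨?_⟩⟩
  · rw [Submodule.mkQ_apply, Submodule.Quotient.mk_eq_zero]
    constructor
    · rintro ⟨ψ, rfl⟩
      exact ⟨ψ ∘ₗ H.subtype, rfl⟩
    · rintro ⟨ψ, rfl⟩
      obtain ⟨χ, rfl⟩ := hdual.surj ψ
      exact ⟨χ, rfl⟩
  -- Reflexivity of `H` and `P₁` identifies the double dual of `k` with `k`, whose cokernel is `A`.
  · let Θ : H →ₗ[S] CokerDual T S D (LinearMap.lcomp T D k) :=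
      (LinearMap.range (LinearMap.lcomp S D (LinearMap.lcomp T D k))).mkQ ∘ₗ evalBidual S T D H
    have hHb := h.evalBidual_bijective (X := H) hH
    have hΘs : Function.Surjective Θ := (Submodule.mkQ_surjective _).comp hHb.2
    have hΘ : Function.Exact k Θ := by
      intro x
      rw [LinearMap.comp_apply, Submodule.mkQ_apply, Submodule.Quotient.mk_eq_zero]
      constructor
      · rintro ⟨η, hη⟩
        obtain ⟨y, rfl⟩ := h.evalBidual_bijective_of_projective.2 η
        exact ⟨y, hHb.1 hη⟩
      · rintro ⟨y, rfl⟩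
        exact ⟨evalBidual S T D P₁ y, rfl⟩
    exact (hk.linearEquivOfSurjective hρs).symm.trans (hΘ.linearEquivOfSurjective hΘs)

/-- A surjective map from a presentation by projective modules to a presentation by Gorenstein
projective modules, with the same cokernel, induces an embedding of the cokernels of the dual maps,
with Gorenstein projective cokernel. -/
theorem IsDualizingPair.exists_embedding_cokerDual [IsNoetherianRing S] [IsNoetherianRing T]
    (h : IsDualizingPair S T D) {X₁ X₀ Q₁ Q₀ : Type u} [AddCommGroup X₁] [AddCommGroup X₀]
    [AddCommGroup Q₁] [AddCommGroup Q₀] [Module S X₁] [Module S X₀] [Module S Q₁] [Module S Q₀]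
    [Module.Finite S Q₁] [Module.Projective S Q₁] [Module.Projective S Q₀]
    (hX₁ : IsGorensteinProjective S X₁) (hX₀ : IsGorensteinProjective S X₀)
    (g : X₁ →ₗ[S] X₀) (d : Q₁ →ₗ[S] Q₀) (a₁ : Q₁ →ₗ[S] X₁) (a₀ : Q₀ →ₗ[S] X₀)
    (hcomm : ∀ x, a₀ (d x) = g (a₁ x)) (ha₁ : Function.Surjective a₁)
    (ha₀ : Function.Surjective a₀) (hker : ∀ y, a₀ y = 0 → ∃ x, d x = y ∧ a₁ x = 0) :
    ∃ (G : ModuleCat.{u} T) (α : CokerDual S T D g →ₗ[T] CokerDual S T D d)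
      (β : CokerDual S T D d →ₗ[T] G), IsSES α β ∧ IsGorensteinProjective T G := by
  -- the pullback of `X₁` and `Q₀` over `X₀`
  let δ : X₁ × Q₀ →ₗ[S] X₀ := g.coprod (-a₀)
  have hδ : ∀ x y, δ (x, y) = g x - a₀ y := fun x y => by simp [δ, sub_eq_add_neg]
  have hδs : Function.Surjective δ := fun x => by
    obtain ⟨y, rfl⟩ := ha₀ x
    exact ⟨(0, -y), by rw [hδ, map_zero, map_neg, sub_neg_eq_add, zero_add]⟩
  have hZ := IsSES.ker hδs
  have hZG := hZ.isGorensteinProjective_left (hX₁.prod (.of_projective S Q₀)) hX₀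
  let c : Q₁ →ₗ[S] LinearMap.ker δ := (a₁.prod d).codRestrict _ fun x => by
    rw [LinearMap.mem_ker]
    exact (hδ _ _).trans (sub_eq_zero.2 (hcomm x).symm)
  -- Surjectivity onto the pullback is where `hker` enters. The kernel of `c` is `ker a₁ ∩ ker d`,
  -- and its dual will be the cokernel of the embedding.
  have hc : Function.Surjective c := by
    rintro ⟨⟨x, y⟩, hxy⟩
    have hxy' : g x = a₀ y := sub_eq_zero.1 ((hδ x y).symm.trans hxy)
    obtain ⟨u, rfl⟩ := ha₁ x
    obtain ⟨v, hv, hv'⟩ := hker (y - d u) (by rw [map_sub, hcomm, hxy', sub_self])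
    exact ⟨u + v, Subtype.ext (Prod.ext
      ((map_add a₁ u v).trans (by rw [hv', add_zero]))
      ((map_add d u v).trans (by rw [hv, add_sub_cancel])))⟩
  have hN := IsSES.ker hc
  have hNG := hN.isGorensteinProjective_left (.of_projective S Q₁) hZG
  have hZd := hZ.dual T (h.extZero hX₀.extAcyclic 0)
  have hNd := hN.dual T (h.extZero hZG.extAcyclic 0)
  let A := LinearMap.range (LinearMap.lcomp T D g)
  let B := LinearMap.range (LinearMap.lcomp T D d)
  have hdN : ∀ x : LinearMap.ker c, d x = 0 := fun x =>
    (Prod.ext_iff.1 (congrArg Subtype.val (LinearMap.mem_ker.1 x.2))).2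
  have haN : ∀ x : LinearMap.ker c, a₁ x = 0 := fun x =>
    (Prod.ext_iff.1 (congrArg Subtype.val (LinearMap.mem_ker.1 x.2))).1
  refine ⟨ModuleCat.of T (LinearMap.ker c →ₗ[S] D),
    A.liftQ (B.mkQ ∘ₗ LinearMap.lcomp T D a₁) ?_,
    B.liftQ (LinearMap.lcomp T D (LinearMap.ker c).subtype) ?_, ⟨?_, fun w => ?_, fun w => ?_⟩,
    h.isGorensteinProjective_dual hNG⟩
  · rintro _ ⟨φ, rfl⟩
    rw [LinearMap.mem_ker, LinearMap.comp_apply, Submodule.mkQ_apply,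
      Submodule.Quotient.mk_eq_zero]
    exact ⟨φ ∘ₗ a₀, LinearMap.ext fun x => congrArg φ (hcomm x)⟩
  · rintro _ ⟨φ, rfl⟩
    exact LinearMap.ext fun x => (congrArg φ (hdN x)).trans (map_zero φ)
  · rw [injective_iff_map_eq_zero]
    intro w hw
    obtain ⟨φ, rfl⟩ := Submodule.mkQ_surjective _ w
    rw [Submodule.mkQ_apply, Submodule.liftQ_apply, LinearMap.comp_apply, Submodule.mkQ_apply,
      Submodule.Quotient.mk_eq_zero] at hw
    obtain ⟨ψ, hψ⟩ := hw
    -- The functional `(φ, -ψ)` vanishes on the pullback, so it factors through `δ`; restricted to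
    -- `X₁` this reads `φ = χ ∘ g`.
    obtain ⟨χ, hχ⟩ := (hZd.exact (φ.coprod (-ψ))).1 (LinearMap.ext fun z => by
      obtain ⟨x, rfl⟩ := hc z
      have h1 : ψ (d x) = φ (a₁ x) := LinearMap.congr_fun hψ x
      change (φ.coprod (-ψ)) (a₁ x, d x) = 0
      simp [h1])
    rw [Submodule.mkQ_apply, Submodule.Quotient.mk_eq_zero]
    refine ⟨χ, LinearMap.ext fun x => ?_⟩
    have h1 : χ (δ (x, 0)) = (φ.coprod (-ψ)) (x, 0) := LinearMap.congr_fun hχ (x, 0)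
    simpa [hδ] using h1
  · obtain ⟨φ, rfl⟩ := Submodule.mkQ_surjective _ w
    rw [Submodule.mkQ_apply, Submodule.liftQ_apply]
    constructor
    · intro hφ
      obtain ⟨χ, rfl⟩ := (hNd.exact φ).1 hφ
      obtain ⟨θ, rfl⟩ := hZd.surj χ
      refine ⟨Submodule.Quotient.mk (θ ∘ₗ LinearMap.inl S X₁ Q₀), ?_⟩
      rw [Submodule.liftQ_apply, LinearMap.comp_apply, Submodule.mkQ_apply,
        Submodule.Quotient.eq]
      refine ⟨-(θ ∘ₗ LinearMap.inr S X₁ Q₀), LinearMap.ext fun x => ?_⟩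
      have h1 : θ (a₁ x, d x) = θ (a₁ x, 0) + θ (0, d x) := by simp [← map_add]
      change -θ (0, d x) = θ (a₁ x, 0) - θ (a₁ x, d x)
      rw [h1]
      abel
    · rintro ⟨v, hv⟩
      obtain ⟨ψ, rfl⟩ := Submodule.mkQ_surjective _ v
      rw [Submodule.mkQ_apply, Submodule.liftQ_apply, LinearMap.comp_apply, Submodule.mkQ_apply,
        Submodule.Quotient.eq] at hv
      obtain ⟨χ, hχ⟩ := hv
      refine LinearMap.ext fun x => ?_
      have h1 : χ (d x) = ψ (a₁ x) - φ x := LinearMap.congr_fun hχ x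
      rw [hdN, haN, map_zero, map_zero, zero_sub] at h1
      exact neg_eq_zero.1 h1.symm
  · obtain ⟨φ, rfl⟩ := hNd.surj w
    exact ⟨Submodule.Quotient.mk φ, rfl⟩

/-- Enlarging the dual of a projective presentation of `B` by a split summand and a projective
module mapped to zero changes the cokernel of its dual by a projective summand. -/
theorem IsDualizingPair.nonempty_cokerDual_equiv (h : IsDualizingPair S T D)
    {P₁ P₀ B F F' : Type u} [AddCommGroup P₁] [AddCommGroup P₀] [AddCommGroup B] [Module S P₁]
    [Module S P₀] [Module S B] [AddCommGroup F] [AddCommGroup F'] [Module T F] [Module T F']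
    [Module.Finite S P₁] [Module.Finite S P₀] [Module.Projective S P₁] [Module.Projective S P₀]
    {f : P₁ →ₗ[S] P₀} {p : P₀ →ₗ[S] B} (hf : Function.Exact f p) (hp : Function.Surjective p) :
    Nonempty ((B × (F' →ₗ[T] D)) ≃ₗ[S] CokerDual T S D
      ((LinearMap.lcomp T D f).prodMap (LinearMap.fst T F F'))) := by
  let d : (P₀ →ₗ[S] D) × (F × F') →ₗ[T] (P₁ →ₗ[S] D) × F :=
    (LinearMap.lcomp T D f).prodMap (LinearMap.fst T F F')
  -- The dual of `F` is left out because it lies in the image of the dual of `d`.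
  let θ : P₀ × (F' →ₗ[T] D) →ₗ[S] ((P₀ →ₗ[S] D) × (F × F') →ₗ[T] D) :=
    (LinearMap.lcomp S D (LinearMap.fst T _ _) ∘ₗ evalBidual S T D P₀).coprod
      (LinearMap.lcomp S D (LinearMap.snd T F F' ∘ₗ LinearMap.snd T (P₀ →ₗ[S] D) (F × F')))
  have hθ : ∀ x φ u y z, θ (x, φ) (u, (y, z)) = u x + φ z := fun x φ u y z => rfl
  let Θ := (LinearMap.range (LinearMap.lcomp S D d)).mkQ ∘ₗ θ
  have hΘs : Function.Surjective Θ := by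
    intro w
    obtain ⟨ψ, rfl⟩ := Submodule.mkQ_surjective _ w
    obtain ⟨x, hx⟩ := (h.evalBidual_bijective_of_projective (X := P₀)).2
      (ψ ∘ₗ LinearMap.inl T _ _)
    refine ⟨(x, ψ ∘ₗ LinearMap.inr T _ _ ∘ₗ LinearMap.inr T F F'), ?_⟩
    rw [LinearMap.comp_apply, Submodule.mkQ_apply, Submodule.mkQ_apply, Submodule.Quotient.eq]
    refine ⟨-(ψ ∘ₗ LinearMap.inr T _ _ ∘ₗ LinearMap.inl T F F' ∘ₗ LinearMap.snd T _ _),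
      LinearMap.ext ?_⟩
    rintro ⟨u, y, z⟩
    have h1 : u x = ψ (u, 0, 0) := LinearMap.congr_fun hx u
    have h2 : ψ (u, y, z) = ψ (u, 0, 0) + ψ (0, 0, z) + ψ (0, y, 0) := by simp [← map_add]
    change -ψ (0, y, 0) = (u x + ψ (0, 0, z)) - ψ (u, y, z)
    rw [h1, h2]
    abel
  have hΘ : Function.Exact (LinearMap.inl S P₀ (F' →ₗ[T] D) ∘ₗ f) Θ := by
    rintro ⟨x, φ⟩
    rw [LinearMap.comp_apply, Submodule.mkQ_apply, Submodule.Quotient.mk_eq_zero]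
    constructor
    · rintro ⟨χ, hχ⟩
      have hχ' : ∀ u y z, χ (u ∘ₗ f, y) = u x + φ z := fun u y z =>
        LinearMap.congr_fun hχ (u, (y, z))
      obtain ⟨x₁, hx₁⟩ := (h.evalBidual_bijective_of_projective (X := P₁)).2
        (χ ∘ₗ LinearMap.inl T _ _)
      have h1 : ∀ u : P₁ →ₗ[S] D, u x₁ = χ (u, 0) := LinearMap.congr_fun hx₁
      refine ⟨x₁, Prod.ext ?_ (LinearMap.ext fun z => ?_)⟩
      · refine (h.evalBidual_bijective_of_projective (X := P₀)).1 (LinearMap.ext fun u => ?_)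
        have h2 := hχ' u 0 0
        rw [map_zero, add_zero, ← h1] at h2
        exact h2
      · have h2 := hχ' 0 0 z
        rw [LinearMap.zero_comp, LinearMap.zero_apply, zero_add] at h2
        exact (map_zero χ).symm.trans h2
    · rintro ⟨x₁, hx₁⟩
      obtain ⟨h1, h2⟩ := Prod.ext_iff.1 hx₁
      change f x₁ = x at h1
      change 0 = φ at h2
      subst h1 h2
      refine ⟨evalBidual S T D P₁ x₁ ∘ₗ LinearMap.fst T _ _, LinearMap.ext ?_⟩
      rintro ⟨u, y, z⟩
      exact (add_zero (u (f x₁))).symm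
  have hpp : Function.Exact (LinearMap.inl S P₀ (F' →ₗ[T] D) ∘ₗ f)
      (p.prodMap (LinearMap.id (R := S) (M := F' →ₗ[T] D))) := by
    rintro ⟨x, φ⟩
    constructor
    · intro hx
      obtain ⟨h1, h2⟩ := Prod.ext_iff.1 hx
      obtain ⟨x₁, hx₁⟩ := (hf x).1 h1
      exact ⟨x₁, Prod.ext hx₁ h2.symm⟩
    · rintro ⟨x₁, hx₁⟩
      rw [← hx₁]
      exact Prod.ext (hf.apply_apply_eq_zero x₁) rfl
  exact ⟨(hpp.linearEquivOfSurjective (hp.prodMap Function.surjective_id)).symm.trans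
    (hΘ.linearEquivOfSurjective hΘs)⟩

theorem Function.Exact.exists_lift_projective {X₁ X₀ M U : Type u} [AddCommGroup X₁]
    [AddCommGroup X₀] [AddCommGroup M] [AddCommGroup U] [Module S X₁] [Module S X₀] [Module S M]
    [Module S U] [Module.Projective S U] {g : X₁ →ₗ[S] X₀} {q : X₀ →ₗ[S] M}
    (hg : Function.Exact g q) (k : U →ₗ[S] X₀) (hk : ∀ u, q (k u) = 0) :
    ∃ β : U →ₗ[S] X₁, ∀ u, g (β u) = k u := by
  obtain ⟨β, hβ⟩ := Module.projective_lifting_property g.rangeRestrict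
    (k.codRestrict _ fun u => (hg _).1 (hk u)) g.surjective_rangeRestrict
  exact ⟨β, fun u => congrArg Subtype.val (LinearMap.congr_fun hβ u)⟩

theorem projectiveDim_eq_of_equiv_prod {B B' P : Type u} [AddCommGroup B] [AddCommGroup B']
    [AddCommGroup P] [Module S B] [Module S B'] [Module S P] [Module.Projective S P]
    (e : (B × P) ≃ₗ[S] B') : projectiveDim S B' = projectiveDim S B := by
  refine eq_of_forall_le_natCast_iff fun m => ?_
  rw [projectiveDim_le_iff (ModuleCat.of S B), projectiveDim_le_iff (ModuleCat.of S B'),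
    hasProjectiveDimensionLE_iff_extZero, hasProjectiveDimensionLE_iff_extZero]
  refine forall_congr' fun i => forall_congr' fun hi => forall_congr' fun Q => ?_
  obtain ⟨j, rfl⟩ : ∃ j, i = j + 1 := ⟨i - 1, by omega⟩
  refine ⟨fun h => h.of_retract (e.toLinearMap ∘ₗ LinearMap.inl S B P)
    (LinearMap.fst S B P ∘ₗ e.symm.toLinearMap) fun x => by simp, fun h => ?_⟩
  exact ((IsSES.inl_snd S B P).extZero_mid h (extZero_of_projective S _ _ _)).of_equiv e

/-- A Gorenstein transpose of a transpose of `B` embeds, with Gorenstein projective cokernel,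
in a finitely generated module with the projective dimension of `B`. -/
theorem IsDualizingPair.exists_embedding_of_transpose [IsNoetherianRing S] [IsNoetherianRing T]
    (h : IsDualizingPair S T D) {A B M : Type u} [AddCommGroup A] [AddCommGroup B]
    [AddCommGroup M] [Module S A] [Module S B] [Module T M]
    (hB : IsTransposeWith S T D B M) (hA : IsGorensteinTransposeWith T S D M A) :
    ∃ (B' G : ModuleCat.{u} S) (a : A →ₗ[S] B') (b : B' →ₗ[S] G), IsSES a b ∧
      IsGorensteinProjective S G ∧ projectiveDim S B' = projectiveDim S B := by
  obtain ⟨P₁, P₀, f, p, hP₁f, hP₀f, hP₁, hP₀, hf, hp, ⟨e⟩⟩ := hB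
  obtain ⟨X₁, X₀, g, q, hX₁f, hX₀f, hX₁, hX₀, hg, hq, ⟨eA⟩⟩ := hA
  have hU := h.finite_projective_dual (X := P₀)
  have hV := h.finite_projective_dual (X := P₁)
  obtain ⟨hUf, hU⟩ := hU
  obtain ⟨hVf, hV⟩ := hV
  let v : (P₁ →ₗ[S] D) →ₗ[T] M :=
    e.symm.toLinearMap ∘ₗ (LinearMap.range (LinearMap.lcomp T D f)).mkQ
  have hv : Function.Exact (LinearMap.lcomp T D f) v := fun φ => by
    rw [LinearMap.comp_apply, LinearEquiv.coe_coe, LinearEquiv.map_eq_zero_iff,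
      Submodule.mkQ_apply, Submodule.Quotient.mk_eq_zero]
    rfl
  -- `α` and `β` lift the identity of `M` to a map from the projective presentation to the
  -- Gorenstein one.
  obtain ⟨α, hα⟩ := Module.projective_lifting_property q v hq
  replace hα : ∀ x, q (α x) = v x := LinearMap.congr_fun hα
  obtain ⟨β, hβ⟩ := hg.exists_lift_projective (α ∘ₗ LinearMap.lcomp T D f) (fun u => by
    rw [LinearMap.comp_apply, hα, hv.apply_apply_eq_zero])
  -- Adding `F` in both degrees makes the comparison onto; `F'`, sent to zero by `d`, corrects
  -- elements of `ker g`, as the kernel condition requires.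
  obtain ⟨F, k, hFf, hF, hk⟩ := exists_finite_projective_cover T X₁
  obtain ⟨F', m, hFf', hF', hm⟩ := exists_finite_projective_cover T (LinearMap.ker g)
  have hgm : ∀ x, g (m x) = 0 := fun x => (m x).2
  let d : (P₀ →ₗ[S] D) × (F × F') →ₗ[T] (P₁ →ₗ[S] D) × F :=
    (LinearMap.lcomp T D f).prodMap (LinearMap.fst T F F')
  let a₁ : (P₀ →ₗ[S] D) × (F × F') →ₗ[T] X₁ :=
    β.coprod (k.coprod ((LinearMap.ker g).subtype ∘ₗ m))
  let a₀ : (P₁ →ₗ[S] D) × F →ₗ[T] X₀ := α.coprod (g ∘ₗ k)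
  have ha₁ : ∀ u y z, a₁ (u, (y, z)) = β u + (k y + m z) := fun u y z => by simp [a₁]
  have ha₀ : ∀ u y, a₀ (u, y) = α u + g (k y) := fun u y => by simp [a₀]
  have hd : ∀ u y z, d (u, (y, z)) = (LinearMap.lcomp T D f u, y) := fun u y z => rfl
  obtain ⟨G, a, b, hab, hG⟩ := h.symm.exists_embedding_cokerDual hX₁ hX₀ g d a₁ a₀
    (by
      rintro ⟨u, y, z⟩
      rw [hd, ha₀, ha₁, map_add, map_add, hβ, hgm, add_zero]
      rfl)
    (fun x => by
      obtain ⟨y, rfl⟩ := hk x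
      exact ⟨(0, (y, 0)), by simp [ha₁]⟩)
    (fun x => by
      obtain ⟨y, hy⟩ : ∃ y, v y = q x := by
        obtain ⟨y, hy⟩ := Submodule.mkQ_surjective _ (e (q x))
        exact ⟨y, (congrArg e.symm hy).trans (e.symm_apply_apply _)⟩
      obtain ⟨z, hz⟩ := (hg (x - α y)).1 (by rw [map_sub, hα, hy, sub_self])
      obtain ⟨w, rfl⟩ := hk z
      exact ⟨(y, w), by rw [ha₀, hz, add_sub_cancel]⟩)
    (by
      rintro ⟨x, y⟩ hxy
      rw [ha₀] at hxy
      obtain ⟨u, rfl⟩ := (hv x).1 (by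
        have := congrArg q hxy
        rwa [map_add, hα, hg.apply_apply_eq_zero, add_zero, map_zero] at this)
      obtain ⟨z, hz⟩ := hm ⟨β u + k y, by
        rw [LinearMap.mem_ker, map_add, hβ]
        exact hxy⟩
      refine ⟨(u, (y, -z)), hd _ _ _, ?_⟩
      rw [ha₁, map_neg, hz]
      simp)
  have hFd := (h.symm.finite_projective_dual (X := F')).2
  obtain ⟨e'⟩ := h.nonempty_cokerDual_equiv (F := F) (F' := F') hf hp
  exact ⟨ModuleCat.of S (CokerDual T S D d), G, a ∘ₗ eA.toLinearMap, b, hab.equiv_left eA, hG,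
    projectiveDim_eq_of_equiv_prod e'⟩

end

theorem isDualizingPair_self (R : Type u) [Ring R] : IsDualizingPair R Rᵐᵒᵖ R := by
  refine ⟨1, ?_, ?_⟩
  · simpa using! Function.bijective_id (α := R)
  · simpa using MulOpposite.unop_bijective

theorem proposition3p6 (R : Type u) [Ring R] [IsNoetherianRing R] [IsNoetherianRing Rᵐᵒᵖ]
    (A : Type u) [AddCommGroup A] [Module R A] [Module.Finite R A] (n : ℕ) :
    gorensteinProjectiveDim R A = n ↔
      ∃ B : ModuleCat.{u} R, Module.Finite R B ∧ projectiveDim R B = n ∧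
        ∃ T : ModuleCat.{u} Rᵐᵒᵖ, IsTranspose R B T ∧ IsGorensteinTransposeOfRight R T A := by
  have h := isDualizingPair_self R
  constructor
  · intro hA
    obtain ⟨B, G, a, b, hs, hB, hG, hpd⟩ := HasGPDimLE.exists_embedding (M := ModuleCat.of R A)
      ((gorensteinProjectiveDim_le_iff (ModuleCat.of R A) n).1 hA.le)
    exact ⟨B, hB, (hs.gorensteinProjectiveDim_eq hG ((projectiveDim_le_iff B n).2 hpd)).symm.trans hA,
      hs.exists_transpose h hG⟩
  · rintro ⟨B, hB, hpd, M, hM, hA⟩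
    obtain ⟨B', G, a, b, hs, hG, hpd'⟩ := h.exists_embedding_of_transpose hM hA
    rw [hs.gorensteinProjectiveDim_eq hG (hpd'.trans hpd).le, hpd', hpd]
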